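/- **Theorem 4.** Let $(X,\mathrm{dist})$ be a metric space. Its doubling dimension is the smallest integer $D$ such that every ball of radius $2r$ $(r>0)$ can be covered by $2^D$ balls of radius $r$ (centered in $X$). For an ordered $k$-tuple of centers $S\in X^k$, a point $p\in X$ and a finite set $P'\subseteq X$ write $\mathrm{cost}(p,S)=\min_{c\in S}\mathrm{dist}(p,c)^2$ and $\mathrm{cost}(P',S)=\sum_{p\in P'}\mathrm{cost}(p,S)$. *Sensitivity Sampling* with $m$ samples, applied to a nonempty finite set $P\subseteq X$ and an integer $k\ge 1$, works as follows. Take a $\gamma$-approximate $k$-means solution $A=(a_1,\dots,a_k)\in X^k$, i.e. $\mathrm{cost}(P,A)\le\gamma\,\mathrm{cost}(P,S)$ for all $S\in X^k$, and partition $P$ into clusters $C_1,\dots,C_k$ by assigning each point to a nearest center $a_j$ (ties broken arbitrarily). For $p\in C_j$ let $\Delta_p=\mathrm{cost}(C_j,A)/|C_j|$ and $$\mu(p)=\frac14\left(\frac1{k|C_j|}+\frac{\mathrm{cost}(p,A)}{k\,\mathrm{cost}(C_j,A)}+\frac{\mathrm{cost}(p,A)}{\mathrm{cost}(P,A)}+\frac{\Delta_p}{\mathrm{cost}(P,A)}\right),$$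 which is a probability distribution on $P$ if all clusters have positive cost; otherwise, read $0/0$ as $0$ and rescale $\mu$ to total mass $1$. Draw $q_1,\dots,q_m\in P$ independently from $\mu$ and give $q_i$ the weight $w_i=1/(m\,\mu(q_i))$. There is an absolute constant $c\in\mathbb N$ such that for every $\gamma\ge1$ and every $\delta\in(0,1)$ there is a constant $C=C(\gamma,\delta)>0$ with the following property. For every metric space $X$ of doubling dimension at most $D$, every nonempty finite $P\subseteq X$, every $k\ge1$, every $\varepsilon\in(0,1)$, every choice of the $\gamma$-approximate solution $A$ and of its clusters, and every number of samples $$m\ \ge\ C\,\frac{kD}{\varepsilon^{2}}\,\Bigl(\log\frac{2k}{\varepsilon}\Bigr)^{c},$$ the output of Sensitivity Sampling is, with probability at least $1-\delta$, an $\varepsilon$-coreset of size $m$ for $k$-means on $P$, i.e. $$\Bigl|\sum_{i=1}^m w_i\,\mathrm{cost}(q_i,S)-\mathrm{cost}(P,S)\Bigr|\le\varepsilon\,\mathrm{cost}(P,S)\qquad\text{for all } S\in X^k\text{ simultaneously.}$$ In particular, a coreset of size $\tilde O(kD/\varepsilon^2)$ suffices, where $\tilde O$ hides factors polylogarithmic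 in $k$ and $1/\varepsilon$. -/

import Mathlib

noncomputable section

namespace KMeans

/-- Every closed ball of radius `2 * r` is covered by at most `2 ^ d` closed balls of radius `r`. -/
def BallsCovered (X : Type*) [MetricSpace X] (d : ℕ) : Prop :=
  ∀ (x : X) (r : ℝ), 0 < r →
    ∃ T : Finset X, T.card ≤ 2 ^ d ∧
      Metric.closedBall x (2 * r) ⊆ ⋃ y ∈ T, Metric.closedBall y r

/-- The doubling dimension of a metric space: the smallest integer `d` such that every ball of
radius `2 * r` can be covered by `2 ^ d` balls of radius `r` (and `⊤` if there is none). -/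
def doublingDim (X : Type*) [MetricSpace X] : ℕ∞ :=
  ⨅ (d : ℕ) (_ : BallsCovered X d), (d : ℕ∞)

section
variable {X : Type*} [MetricSpace X] {k : ℕ}

/-- The squared distance of `p` to its nearest center in the ordered `k`-tuple `S`. -/
def pointCost (S : Fin k → X) (p : X) : ℝ := ⨅ j, dist p (S j) ^ 2

/-- The `k`-means cost of a finite set of points. -/
def cost (P : Finset X) (S : Fin k → X) : ℝ := ∑ p ∈ P, pointCost S p

/-- `A` is a `γ`-approximate `k`-means solution for `P`; the centers range over all of `X`. -/
def IsApproxSolution (γ : ℝ) (P : Finset X) (A : Fin k → X) : Prop :=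
  ∀ S : Fin k → X, cost P A ≤ γ * cost P S

/-- `σ` assigns every point of `P` to a nearest center of `A` (ties are broken arbitrarily). -/
def IsNearestAssignment (P : Finset X) (A : Fin k → X) (σ : X → Fin k) : Prop :=
  ∀ p ∈ P, ∀ j, dist p (A (σ p)) ≤ dist p (A j)

/-- The cluster of the points of `P` that are assigned to the center with index `j`. -/
def cluster (P : Finset X) (σ : X → Fin k) (j : Fin k) : Finset X := P.filter fun p => σ p = j

/-- The average cost of a point in the cluster of `p`. -/
def avgCost (P : Finset X) (A : Fin k → X) (σ : X → Fin k) (p : X) : ℝ :=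
  cost (cluster P σ (σ p)) A / ((cluster P σ (σ p)).card : ℝ)

/-- The score that sensitivity sampling gives to a point. A quotient with denominator `0`
(which occurs for clusters of cost `0`) counts as `0`. -/
def score (P : Finset X) (A : Fin k → X) (σ : X → Fin k) (p : X) : ℝ :=
  1 / 4 * (1 / ((k : ℝ) * ((cluster P σ (σ p)).card : ℝ))
    + pointCost A p / ((k : ℝ) * cost (cluster P σ (σ p)) A)
    + pointCost A p / cost P A
    + avgCost P A σ p / cost P A)

/-- The sampling distribution on `P`. The scores sum to `1` if all `k` clusters have positive
cost (see `sum_score`), and then this is the score itself; otherwise they are rescaled to sum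
to `1`. -/
def samplingProb (P : Finset X) (A : Fin k → X) (σ : X → Fin k) (p : X) : ℝ :=
  score P A σ p / ∑ x ∈ P, score P A σ x

/-- The probability of the event `E` for a sample of `m` independent points of `P`, each drawn
from the sampling distribution. -/
def sampleProbability (P : Finset X) (A : Fin k → X) (σ : X → Fin k) (m : ℕ)
    (E : Set (Fin m → P)) : ℝ :=
  ∑ q : Fin m → P, E.indicator (fun q => ∏ i, samplingProb P A σ (q i)) q

/-- The weight `1 / (m * μ(p))` of a sampled point. -/
def sampleWeight (P : Finset X) (A : Fin k → X) (σ : X → Fin k) (m : ℕ) (p : X) : ℝ :=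
  1 / ((m : ℝ) * samplingProb P A σ p)

/-- The points `q 0, …, q (m - 1)` with weights `w 0, …, w (m - 1)` form an `ε`-coreset, of
size `m`, of `P` for `k`-means: the weighted cost is within a factor `1 ± ε` of the cost of `P`,
simultaneously for all choices of `k` centers in the space. -/
def IsCoreset (k : ℕ) (ε : ℝ) (P : Finset X) {m : ℕ} (q : Fin m → X) (w : Fin m → ℝ) : Prop :=
  ∀ S : Fin k → X, |(∑ i, w i * pointCost S (q i)) - cost P S| ≤ ε * cost P S

/-- The scores form a probability distribution if every cluster has positive cost. -/
theorem sum_score (hk : 1 ≤ k) (P : Finset X) (A : Fin k → X) (σ : X → Fin k)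
    (h : ∀ j, 0 < cost (cluster P σ j) A) : ∑ p ∈ P, score P A σ p = 1 := by
  have hk0 : (k : ℝ) ≠ 0 := by positivity
  have hcard : ∀ j, ((cluster P σ j).card : ℝ) ≠ 0 := by
    intro j hj
    have h0 : cluster P σ j = ∅ := by simpa using hj
    have := h j
    simp [h0, cost] at this
  have hsum : ∀ f : X → ℝ, ∑ p ∈ P, f p = ∑ j, ∑ p ∈ cluster P σ j, f p := fun f =>
    (Finset.sum_fiberwise P σ f).symm
  have htot : cost P A = ∑ j, cost (cluster P σ j) A := hsum _
  have hpos : cost P A ≠ 0 := by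
    rw [htot]
    exact (Finset.sum_pos (fun j _ => h j) ⟨⟨0, hk⟩, Finset.mem_univ _⟩).ne'
  have key : ∀ j, ∑ p ∈ cluster P σ j, score P A σ p
      = 1 / 4 * (1 / k + 1 / k + cost (cluster P σ j) A / cost P A
        + cost (cluster P σ j) A / cost P A) := by
    intro j
    have e : ∀ p ∈ cluster P σ j, score P A σ p
        = 1 / 4 * (1 / ((k : ℝ) * ((cluster P σ j).card : ℝ))
          + pointCost A p / ((k : ℝ) * cost (cluster P σ j) A) + pointCost A p / cost P A
          + cost (cluster P σ j) A / ((cluster P σ j).card : ℝ) / cost P A) := by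
      intro p hp
      have hp' : σ p = j := (Finset.mem_filter.mp hp).2
      simp only [score, avgCost, hp']
    rw [Finset.sum_congr rfl e, ← Finset.mul_sum, Finset.sum_add_distrib, Finset.sum_add_distrib,
      Finset.sum_add_distrib, ← Finset.sum_div, ← Finset.sum_div, ← Finset.sum_div, Finset.sum_const,
      Finset.sum_const, nsmul_eq_mul, nsmul_eq_mul]
    have e2 : ∑ p ∈ cluster P σ j, pointCost A p = cost (cluster P σ j) A := rfl
    simp only [e2]
    have h1 := hcard j
    have h2 := (h j).ne'
    field_simp
  rw [hsum, Finset.sum_congr rfl fun j _ => key j, ← Finset.mul_sum, Finset.sum_add_distrib,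
    Finset.sum_add_distrib, ← Finset.sum_div, ← htot, Finset.sum_const, nsmul_eq_mul,
    Finset.card_univ, Fintype.card_fin]
  field_simp
  norm_num

end

end KMeans

end

open KMeans

/-!
The cost of a point `p` for the centers `S` is the cost of its reference center `A (σ p)` plus a
residual, which may be replaced by `0` when `A (σ p)` is much closer to `p` than to `S`. The sum of
the first parts only depends on the sizes of the clusters, and the sample estimates these well. For
a fixed `S`, the ratio of the residual of `p` to its sampling probability is `O(cost P S / ε)` and
has second moment `O(cost P S ^ 2)`, so by a Chernoff bound the probability that the residuals are
estimated with a large error is exponentially small in `m ε ^ 2`.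

To treat all `S` at once, classify a center by its nearest reference center, by the level of its
distance to `A` among quantiles of the point costs, and by its cell in a net, provided by the
doubling dimension, of the largest ball belonging to this level. Exchanging centers of the same
class changes the residuals little, except at points whose distance to `A`, scaled up by a factor
of order `1 / ε`, falls into the level of the center; these have small total cost because the levels
are quantiles. A union bound over one cheap representative for each of the few classes of `k`-tuples
completes the argument.
-/

noncomputable section

namespace KMeans

open Set Metric

section ProductProb
variable {α : Type*} [Fintype α] {μ : α → ℝ} {m : ℕ}

/-- The probability of the event `E` for `m` independent draws from the distribution `μ` on a
finite type. -/
def productProb (μ : α → ℝ) (m : ℕ) (E : Set (Fin m → α)) : ℝ :=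
  ∑ q : Fin m → α, E.indicator (fun q => ∏ i, μ (q i)) q

theorem productProb_nonneg (hμ : ∀ a, 0 ≤ μ a) (E : Set (Fin m → α)) : 0 ≤ productProb μ m E :=
  Finset.sum_nonneg fun _ _ => indicator_apply_nonneg fun _ => Finset.prod_nonneg fun _ _ => hμ _

theorem productProb_univ (hsum : ∑ a, μ a = 1) : productProb μ m univ = 1 := by
  simp only [productProb, indicator_univ]
  rw [← Fintype.sum_pow, hsum, one_pow]

theorem productProb_mono (hμ : ∀ a, 0 ≤ μ a) {E F : Set (Fin m → α)} (h : E ⊆ F) :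
    productProb μ m E ≤ productProb μ m F :=
  Finset.sum_le_sum fun _ _ =>
    indicator_le_indicator_of_subset h (fun _ => Finset.prod_nonneg fun _ _ => hμ _) _

theorem productProb_iUnion_le_sum (hμ : ∀ a, 0 ≤ μ a) {ι : Type*} [Fintype ι]
    (E : ι → Set (Fin m → α)) : productProb μ m (⋃ i, E i) ≤ ∑ i, productProb μ m (E i) := by
  simp only [productProb]
  rw [Finset.sum_comm]
  refine Finset.sum_le_sum fun q _ => ?_
  have hq : 0 ≤ ∏ i, μ (q i) := Finset.prod_nonneg fun _ _ => hμ _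
  have hE : ∀ i, 0 ≤ (E i).indicator (fun q => ∏ i, μ (q i)) q := fun i =>
    indicator_apply_nonneg fun _ => hq
  refine indicator_apply_le' (fun hmem => ?_) fun _ => Finset.sum_nonneg fun i _ => hE i
  obtain ⟨i, hi⟩ := mem_iUnion.1 hmem
  rw [← indicator_of_mem hi fun q => ∏ i, μ (q i)]
  exact Finset.single_le_sum (fun i _ => hE i) (Finset.mem_univ i)

theorem productProb_union_le (hμ : ∀ a, 0 ≤ μ a) (E F : Set (Fin m → α)) :
    productProb μ m (E ∪ F) ≤ productProb μ m E + productProb μ m F := by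
  simpa [union_eq_iUnion] using productProb_iUnion_le_sum hμ fun b : Bool => cond b E F

theorem productProb_iUnion_le_card_mul (hμ : ∀ a, 0 ≤ μ a) {ι : Type*} [Fintype ι]
    {E : ι → Set (Fin m → α)} {b : ℝ} (hb : ∀ i, productProb μ m (E i) ≤ b) :
    productProb μ m (⋃ i, E i) ≤ Fintype.card ι * b := by
  refine (productProb_iUnion_le_sum hμ E).trans ((Finset.sum_le_sum fun i _ => hb i).trans ?_)
  simp

theorem one_sub_productProb_le (hμ : ∀ a, 0 ≤ μ a) (hsum : ∑ a, μ a = 1) {E B : Set (Fin m → α)}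
    (h : Bᶜ ⊆ E) : 1 - productProb μ m B ≤ productProb μ m E := by
  have hcover : productProb μ m univ ≤ productProb μ m (E ∪ B) :=
    productProb_mono hμ fun q _ => (em (q ∈ B)).elim Or.inr fun hq => Or.inl (h hq)
  linarith [productProb_union_le hμ E B, productProb_univ (m := m) hsum]

theorem productProb_le_exp_neg_mul_pow (hμ : ∀ a, 0 ≤ μ a) (g : α → ℝ) (t : ℝ) :
    productProb μ m {q | t ≤ ∑ i, g (q i)}
      ≤ Real.exp (-t) * (∑ a, Real.exp (g a) * μ a) ^ m := by
  rw [Fintype.sum_pow, Finset.mul_sum]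
  refine Finset.sum_le_sum fun q _ => ?_
  have hq : 0 ≤ ∏ i, μ (q i) := Finset.prod_nonneg fun _ _ => hμ _
  rw [Finset.prod_mul_distrib, ← Real.exp_sum, ← mul_assoc, ← Real.exp_add]
  refine indicator_apply_le' (fun hmem => ?_) fun _ => by positivity
  have hmem' : t ≤ ∑ i, g (q i) := hmem
  exact le_mul_of_one_le_left hq (Real.one_le_exp (by linarith))

theorem sum_exp_div_mul_le (hμ : ∀ a, 0 ≤ μ a) (hsum : ∑ a, μ a = 1) {f : α → ℝ}
    (hf : ∀ a, |f a| ≤ μ a) :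
    ∑ a, Real.exp (f a / μ a) * μ a ≤ Real.exp (∑ a, f a + ∑ a, f a ^ 2 / μ a) := by
  have hterm : ∀ a, Real.exp (f a / μ a) * μ a ≤ μ a + f a + f a ^ 2 / μ a := by
    intro a
    rcases (hμ a).eq_or_lt with h | h
    · have hfa : f a = 0 := abs_nonpos_iff.1 ((hf a).trans h.ge)
      simp [← h, hfa]
    · have hquot : |f a / μ a| ≤ 1 := by rw [abs_div, abs_of_pos h, div_le_one h]; exact hf a
      have hexp := (abs_le.1 (Real.abs_exp_sub_one_sub_id_le hquot)).2
      calc Real.exp (f a / μ a) * μ a ≤ (1 + f a / μ a + (f a / μ a) ^ 2) * μ a := by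
            gcongr; linarith
        _ = μ a + f a + f a ^ 2 / μ a := by field_simp
  calc ∑ a, Real.exp (f a / μ a) * μ a ≤ ∑ a, (μ a + f a + f a ^ 2 / μ a) :=
        Finset.sum_le_sum fun a _ => hterm a
    _ = (∑ a, f a + ∑ a, f a ^ 2 / μ a) + 1 := by
        rw [Finset.sum_add_distrib, Finset.sum_add_distrib, hsum]; ring
    _ ≤ Real.exp (∑ a, f a + ∑ a, f a ^ 2 / μ a) := Real.add_one_le_exp _

theorem productProb_upper_tail_le (hμ : ∀ a, 0 ≤ μ a) (hsum : ∑ a, μ a = 1) {f : α → ℝ}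
    (hf : ∀ a, |f a| ≤ μ a) (t : ℝ) :
    productProb μ m {q | t ≤ ∑ i, f (q i) / μ (q i) - m * ∑ a, f a}
      ≤ Real.exp (m * ∑ a, f a ^ 2 / μ a - t) := by
  have hmgf := pow_le_pow_left₀
    (Finset.sum_nonneg fun a _ => mul_nonneg (Real.exp_nonneg _) (hμ a))
    (sum_exp_div_mul_le hμ hsum hf) m
  calc productProb μ m {q | t ≤ ∑ i, f (q i) / μ (q i) - m * ∑ a, f a}
      = productProb μ m {q | t + m * ∑ a, f a ≤ ∑ i, f (q i) / μ (q i)} := by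
        simp only [le_sub_iff_add_le]
    _ ≤ Real.exp (-(t + m * ∑ a, f a)) * (∑ a, Real.exp (f a / μ a) * μ a) ^ m :=
        productProb_le_exp_neg_mul_pow hμ (fun a => f a / μ a) _
    _ ≤ Real.exp (-(t + m * ∑ a, f a)) * Real.exp (∑ a, f a + ∑ a, f a ^ 2 / μ a) ^ m := by gcongr
    _ = Real.exp (m * ∑ a, f a ^ 2 / μ a - t) := by
        rw [← Real.exp_nat_mul, ← Real.exp_add]; congr 1; ring

theorem productProb_abs_tail_le (hμ : ∀ a, 0 ≤ μ a) (hsum : ∑ a, μ a = 1) {f : α → ℝ}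
    (hf : ∀ a, |f a| ≤ μ a) (t : ℝ) :
    productProb μ m {q | t ≤ |∑ i, f (q i) / μ (q i) - m * ∑ a, f a|}
      ≤ 2 * Real.exp (m * ∑ a, f a ^ 2 / μ a - t) := by
  have hupper := productProb_upper_tail_le (m := m) hμ hsum hf t
  have hlower := productProb_upper_tail_le (m := m) (f := fun a => -f a) hμ hsum
    (by simpa only [abs_neg] using hf) t
  simp only [neg_sq, neg_div, Finset.sum_neg_distrib] at hlower
  have hsub : {q : Fin m → α | t ≤ |∑ i, f (q i) / μ (q i) - m * ∑ a, f a|} ⊆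
      {q | t ≤ ∑ i, f (q i) / μ (q i) - m * ∑ a, f a} ∪
        {q | t ≤ -∑ i, f (q i) / μ (q i) - m * -∑ a, f a} := by
    intro q hq
    rcases le_abs.1 (show t ≤ |_| from hq) with h | h
    · exact Or.inl h
    · exact Or.inr (h.trans_eq (by ring))
  linarith [productProb_mono hμ hsub, productProb_union_le hμ
    {q : Fin m → α | t ≤ ∑ i, f (q i) / μ (q i) - m * ∑ a, f a}
    {q | t ≤ -∑ i, f (q i) / μ (q i) - m * -∑ a, f a}]

end ProductProb

section Covering
variable {X : Type*} [MetricSpace X] {d D : ℕ}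

theorem BallsCovered.mono (h : BallsCovered X d) (hd : d ≤ D) : BallsCovered X D := fun x r hr =>
  let ⟨T, hT, hcover⟩ := h x r hr
  ⟨T, hT.trans (Nat.pow_le_pow_right two_pos hd), hcover⟩

theorem ballsCovered_of_doublingDim_le (h : doublingDim X ≤ D) : BallsCovered X D := by
  have hlt : doublingDim X < (D + 1 : ℕ) := h.trans_lt (by exact_mod_cast D.lt_succ_self)
  simp only [doublingDim, iInf_lt_iff] at hlt
  obtain ⟨d, hd, hdD⟩ := hlt
  exact hd.mono (Nat.lt_succ_iff.1 (by exact_mod_cast hdD))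

theorem BallsCovered.iterate (h : BallsCovered X D) (n : ℕ) (x : X) {R : ℝ} (hR : 0 < R) :
    ∃ T : Finset X, T.card ≤ 2 ^ (D * n) ∧ closedBall x R ⊆ ⋃ y ∈ T, closedBall y (R / 2 ^ n) := by
  classical
  induction n with
  | zero => exact ⟨{x}, by simp, by simp⟩
  | succ n ih =>
    obtain ⟨T, hT, hcover⟩ := ih
    have hhalf : 2 * (R / 2 ^ (n + 1)) = R / 2 ^ n := by rw [pow_succ]; field_simp
    choose U hU hUcover using fun y => h y (R / 2 ^ (n + 1)) (by positivity)
    refine ⟨T.biUnion U, ?_, fun z hz => ?_⟩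
    · rw [Nat.mul_succ, pow_add]
      exact (Finset.card_biUnion_le_card_mul _ _ _ fun y _ => hU y).trans
        (Nat.mul_le_mul_right _ hT)
    · obtain ⟨y, hy, hzy⟩ := mem_iUnion₂.1 (hcover hz)
      obtain ⟨u, hu, hzu⟩ := mem_iUnion₂.1 (hUcover y (hhalf ▸ hzy))
      exact mem_iUnion₂.2 ⟨u, Finset.mem_biUnion.2 ⟨y, hy, hu⟩, hzu⟩

theorem BallsCovered.exists_cell (h : BallsCovered X D) (n : ℕ) (x : X) (R : ℝ) :
    ∃ cell : X → Fin (2 ^ (D * n)), ∀ z z', dist z x ≤ R → dist z' x ≤ R → cell z = cell z' →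
      dist z z' ≤ 2 * (R / 2 ^ n) := by
  rcases le_or_gt R 0 with hR | hR
  · refine ⟨fun _ => ⟨0, by positivity⟩, fun z z' hz hz' _ => ?_⟩
    obtain rfl : R = 0 := hR.antisymm (dist_nonneg.trans hz)
    rw [dist_le_zero.1 hz, dist_le_zero.1 hz']
    simp
  · obtain ⟨T, hT, hcover⟩ := h.iterate n x hR
    have hcenter : ∀ z, dist z x ≤ R → ∃ y : T, dist z y ≤ R / 2 ^ n := fun z hz => by
      simpa using hcover hz
    have hx : Nonempty T := ⟨(hcenter x (by simpa using hR.le)).choose⟩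
    choose! center hdist using hcenter
    refine ⟨fun z => Fin.castLE hT (T.equivFin (center z)), fun z z' hz hz' hcell => ?_⟩
    have hcell' : center z = center z' := by simpa using hcell
    linarith [hdist z hz, hcell' ▸ hdist z' hz', dist_triangle_right z z' (center z)]

theorem BallsCovered.subsingleton (h : BallsCovered X 0) : Subsingleton X := by
  refine ⟨fun x y => ?_⟩
  obtain ⟨cell, hcell⟩ := h.exists_cell 2 x (dist y x)
  have hclose := hcell x y (by simp) le_rfl
    (Fin.ext (by have := (cell x).2; have := (cell y).2; simp at *))
  rw [dist_comm y x] at hclose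
  exact dist_le_zero.1 (by linarith)

end Covering

theorem exists_quantile_level {α β : Type*} [LinearOrder β] (P : Finset α) (r : α → β) {v : α → ℝ}
    (hv : ∀ p, 0 ≤ v p) {N : ℕ} (hN : 0 < N) :
    ∃ level : β → Fin (N + 1), ∀ i, ∀ E ⊆ P,
      (∀ p ∈ E, ∃ x y, level x = i ∧ level y = i ∧ x ≤ r p ∧ r p < y) →
      ∑ p ∈ E, v p ≤ (∑ p ∈ P, v p) / N := by
  classical
  set V := ∑ p ∈ P, v p
  let F : β → ℝ := fun x => ∑ p ∈ P with x ≤ r p, v p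
  have hF0 : ∀ x, 0 ≤ F x := fun x => Finset.sum_nonneg fun p _ => hv p
  have hFV : ∀ x, F x ≤ V := fun x =>
    Finset.sum_le_sum_of_subset_of_nonneg (Finset.filter_subset _ _) fun p _ _ => hv p
  have hV : 0 ≤ V := Finset.sum_nonneg fun p _ => hv p
  have hlevel : ∀ x, ⌊N * F x / V⌋₊ < N + 1 := fun x => Nat.lt_succ_of_le <|
    Nat.floor_le_of_le (div_le_of_le_mul₀ hV (by positivity) (by have := hFV x; gcongr))
  refine ⟨fun x => ⟨⌊N * F x / V⌋₊, hlevel x⟩, fun i E hEP hE => ?_⟩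
  have hEV : ∑ p ∈ E, v p ≤ V := Finset.sum_le_sum_of_subset_of_nonneg hEP fun p _ _ => hv p
  rcases E.eq_empty_or_nonempty with rfl | hne
  · simpa using by positivity
  rcases hV.eq_or_lt with hV0 | hVpos
  · rw [← hV0] at hEV ⊢; simpa using hEV
  obtain ⟨p, hp, hpmin⟩ := E.exists_min_image r hne
  obtain ⟨q, hq, hqmax⟩ := E.exists_max_image r hne
  obtain ⟨x, -, hx, -, hxp, -⟩ := hE p hp
  obtain ⟨-, y, -, hy, -, hqy⟩ := hE q hq
  have hmass : ∑ p ∈ E, v p + F y ≤ F x := by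
    have hdisj : Disjoint E (P.filter fun p => y ≤ r p) := Finset.disjoint_left.2 fun z hz hzy =>
      ((hqmax z hz).trans_lt hqy).not_ge (Finset.mem_filter.1 hzy).2
    rw [← Finset.sum_union hdisj]
    refine Finset.sum_le_sum_of_subset_of_nonneg (Finset.union_subset (fun z hz => ?_) ?_)
      fun p _ _ => hv p
    · exact Finset.mem_filter.2 ⟨hEP hz, hxp.trans (hpmin z hz)⟩
    · exact Finset.monotone_filter_right _ fun z _ hyz =>
        (hxp.trans (hpmin q hq)).trans (hqy.le.trans hyz)
  have hfloor : ⌊N * F x / V⌋₊ = ⌊N * F y / V⌋₊ := congrArg Fin.val (hx.trans hy.symm)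
  have hgap : N * F x / V < N * F y / V + 1 := by
    have hylow := Nat.floor_le (a := N * F y / V) (by have := hF0 y; positivity)
    rw [← hfloor] at hylow
    linarith [Nat.lt_floor_add_one (N * F x / V)]
  have hN' : (0 : ℝ) < N := by exact_mod_cast hN
  rw [div_add_one hVpos.ne', div_lt_div_iff_of_pos_right hVpos] at hgap
  rw [le_div_iff₀ hN']
  nlinarith

section InfDist
variable {X : Type*} [PseudoMetricSpace X] {e M b : ℝ} {s : Set X} {x y z : X}

theorem abs_infDist_sq_sub_le :
    |infDist x s ^ 2 - infDist y s ^ 2| ≤ 2 * infDist y s * dist x y + dist x y ^ 2 := by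
  have hy : 0 ≤ infDist y s := infDist_nonneg
  have hd : |infDist x s - infDist y s| ≤ dist x y := by
    rw [abs_le]
    have hyx : infDist y s ≤ infDist x s + dist y x := infDist_le_infDist_add_dist
    rw [dist_comm] at hyx
    constructor <;> linarith [infDist_le_infDist_add_dist (s := s) (x := x) (y := y)]
  calc |infDist x s ^ 2 - infDist y s ^ 2|
      = |2 * infDist y s * (infDist x s - infDist y s) + (infDist x s - infDist y s) ^ 2| := by
        congr 1; ring
    _ ≤ 2 * infDist y s * |infDist x s - infDist y s| + |infDist x s - infDist y s| ^ 2 := by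
        refine (abs_add_le _ _).trans_eq ?_
        rw [abs_mul, abs_of_nonneg (by positivity : 0 ≤ 2 * infDist y s), abs_pow]
    _ ≤ 2 * infDist y s * dist x y + dist x y ^ 2 := by gcongr

variable {ι : Type*} [Finite ι] [Nonempty ι] {S S' : ι → X}

theorem exists_infDist_range_eq (S : ι → X) (x : X) : ∃ i, infDist x (range S) = dist x (S i) := by
  obtain ⟨_, ⟨i, rfl⟩, hi⟩ := (finite_range S).isCompact.exists_infDist_eq_dist (range_nonempty S) x
  exact ⟨i, hi⟩

theorem infDist_range_le_add (hM : infDist z (range S) ≤ M)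
    (h : ∀ i, dist (S i) (S' i) ≤ b ∨ M < dist z (S i) ∧ M < dist z (S' i)) :
    infDist z (range S') ≤ infDist z (range S) + b := by
  obtain ⟨i, hi⟩ := exists_infDist_range_eq S z
  rcases h i with hclose | hfar
  · linarith [infDist_le_dist_of_mem (x := z) (mem_range_self (f := S') i),
      dist_triangle z (S i) (S' i)]
  · linarith [hfar.1]

theorem abs_infDist_range_sq_sub_le (hM : infDist z (range S) ≤ M) (hM' : infDist z (range S') ≤ M)
    (h : ∀ i, dist (S i) (S' i) ≤ b ∨ M < dist z (S i) ∧ M < dist z (S' i)) :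
    |infDist z (range S) ^ 2 - infDist z (range S') ^ 2| ≤ 2 * M * b := by
  have hle := infDist_range_le_add hM h
  have hle' := infDist_range_le_add (S' := S) hM' fun i => by
    rw [dist_comm (S' i)]; exact (h i).imp id And.symm
  have h0 : 0 ≤ infDist z (range S) := infDist_nonneg
  have h0' : 0 ≤ infDist z (range S') := infDist_nonneg
  rw [sq_sub_sq, abs_mul, abs_of_nonneg (add_nonneg h0 h0')]
  refine mul_le_mul (by linarith) (abs_le.2 ⟨by linarith, by linarith⟩) (abs_nonneg _) (by linarith)

end InfDist

section Cost
variable {X : Type*} [MetricSpace X] {k : ℕ} {P : Finset X} {A S : Fin k → X} {σ : X → Fin k}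
  {p : X}

theorem pointCost_eq_infDist_sq (S : Fin k → X) (p : X) :
    pointCost S p = infDist p (range S) ^ 2 := by
  rcases isEmpty_or_nonempty (Fin k) with _ | _
  · simp [pointCost, range_eq_empty]
  · obtain ⟨j, hj⟩ := exists_infDist_range_eq S p
    refine le_antisymm ?_ (le_ciInf fun i => ?_)
    · rw [hj]
      exact ciInf_le (finite_range _).bddBelow j
    · exact pow_le_pow_left₀ infDist_nonneg (infDist_le_dist_of_mem (mem_range_self i)) 2

theorem pointCost_nonneg (S : Fin k → X) (p : X) : 0 ≤ pointCost S p := by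
  rw [pointCost_eq_infDist_sq]; positivity

theorem cost_nonneg (P : Finset X) (S : Fin k → X) : 0 ≤ cost P S :=
  Finset.sum_nonneg fun _ _ => pointCost_nonneg S _

theorem IsNearestAssignment.dist_eq (hσ : IsNearestAssignment P A σ) (hp : p ∈ P) :
    dist p (A (σ p)) = infDist p (range A) :=
  ((le_infDist ⟨A (σ p), mem_range_self _⟩).2 (forall_mem_range.2 (hσ p hp))).antisymm
    (infDist_le_dist_of_mem (mem_range_self _))

theorem IsNearestAssignment.dist_sq_eq (hσ : IsNearestAssignment P A σ) (hp : p ∈ P) :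
    dist p (A (σ p)) ^ 2 = pointCost A p := by
  rw [pointCost_eq_infDist_sq, hσ.dist_eq hp]

end Cost

/-- Replacing the center `s` by `s'` hardly matters for a point at distance `r` from the reference
set `c`: either the two centers are close on the scale `r`, or both are far away from `c`. -/
def Interchangeable {X : Type*} [PseudoMetricSpace X] (e r : ℝ) (c : Set X) (s s' : X) :
    Prop :=
  dist s s' ≤ e ^ 2 * r ∨ (3 * r < e * infDist s c ∧ 3 * r < e * infDist s' c)

section CenterClassification
variable {X : Type*} [MetricSpace X] {k : ℕ} {e b : ℝ} {P : Finset X} {A : Fin k → X} {D : ℕ}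

/-- `θ` sorts the points of the space into classes such that two centers of the same class `a` are
interchangeable for every point of `P` outside an exceptional set `E a` of cost at most `b`. -/
structure IsCenterClassification {Θ : Type*} (e b : ℝ) (P : Finset X) (A : Fin k → X) (θ : X → Θ)
    (E : Θ → Finset X) : Prop where
  subset : ∀ a, E a ⊆ P
  cost_le : ∀ a, cost (E a) A ≤ b
  interchangeable : ∀ {s s'}, θ s = θ s' → ∀ p ∈ P, p ∉ E (θ s) →
    Interchangeable e (infDist p (range A)) (range A) s s'

theorem BallsCovered.exists_cell_of_level {ι β : Type*} [Finite ι] [Nonempty ι]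
    (hX : BallsCovered X D) (n : ℕ) (A : ι → X) (level : ℝ → β) :
    ∃ (near : X → ι) (cell : X → Fin (2 ^ (D * n))), ∀ s s' ρ, near s = near s' →
      level (infDist s (range A)) = level (infDist s' (range A)) → cell s = cell s' →
      (∀ x, level x = level (infDist s (range A)) → x ≤ ρ) → dist s s' ≤ 2 * (ρ / 2 ^ n) := by
  choose near hnear using exists_infDist_range_eq A
  -- The net for a level lives in the largest ball whose radius has this level.
  let radius : β → ℝ := fun i => sSup {x | level x = i}
  choose cell hcell using fun j i => hX.exists_cell n (A j) (radius i)
  refine ⟨near, fun s => cell (near s) (level (infDist s (range A))) s, ?_⟩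
  intro s s' ρ hj hlevel hs hρ
  have hradius : ∀ t, level (infDist t (range A)) = level (infDist s (range A)) →
      dist t (A (near t)) ≤ radius (level (infDist s (range A))) := fun t ht =>
    hnear t ▸ le_csSup ⟨ρ, hρ⟩ ht
  simp only [← hj, ← hlevel] at hs
  calc dist s s' ≤ 2 * (radius (level (infDist s (range A))) / 2 ^ n) :=
        hcell _ _ s s' (hradius s rfl) (hj ▸ hradius s' hlevel.symm) hs
    _ ≤ 2 * (ρ / 2 ^ n) := by
        have : radius (level (infDist s (range A))) ≤ ρ := csSup_le ⟨_, rfl⟩ hρ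
        gcongr

theorem BallsCovered.exists_isCenterClassification [NeZero k] (hX : BallsCovered X D)
    (P : Finset X) (A : Fin k → X) (he : 0 < e) {N n : ℕ} (hN : 0 < N) (hn : 6 / e ^ 3 ≤ 2 ^ n) :
    ∃ (θ : X → Fin k × Fin (N + 1) × Fin (2 ^ (D * n)))
      (E : Fin k × Fin (N + 1) × Fin (2 ^ (D * n)) → Finset X),
      IsCenterClassification e (cost P A / N) P A θ E := by
  classical
  let r : X → ℝ := fun p => 3 * infDist p (range A) / e
  obtain ⟨level, hlevel⟩ := exists_quantile_level P r (pointCost_nonneg A) hN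
  obtain ⟨near, cell, hcell⟩ := hX.exists_cell_of_level n A level
  let i : X → Fin (N + 1) := fun s => level (infDist s (range A))
  let E : Fin (N + 1) → Finset X := fun i =>
    P.filter fun p => ∃ x y, level x = i ∧ level y = i ∧ x ≤ r p ∧ r p < y
  refine ⟨fun s => (near s, i s, cell s), fun a => E a.2.1, fun a => Finset.filter_subset _ _,
    fun a => hlevel _ _ (Finset.filter_subset _ _) fun p hp => (Finset.mem_filter.1 hp).2, ?_⟩
  intro s s' hθ p hp hpE
  obtain ⟨hnear, hi, hs⟩ : near s = near s' ∧ i s = i s' ∧ cell s = cell s' := by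
    simpa only [Prod.mk.injEq] using hθ
  by_cases hfar : r p < infDist s (range A) ∧ r p < infDist s' (range A)
  · exact Or.inr (hfar.imp (fun h => (div_lt_iff₀' he).1 h) fun h => (div_lt_iff₀' he).1 h)
  have hle : ∀ y, level y = i s → y ≤ r p := by
    intro y hy
    by_contra! hlt
    refine hpE (Finset.mem_filter.2 ⟨hp, ?_⟩)
    rcases not_and_or.1 hfar with h | h
    · exact ⟨_, y, rfl, hy, not_lt.1 h, hlt⟩
    · exact ⟨_, y, hi.symm, hy, not_lt.1 h, hlt⟩
  refine Or.inl ?_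
  calc dist s s' ≤ 2 * (r p / 2 ^ n) := hcell s s' (r p) hnear hi hs hle
    _ = 6 / e ^ 3 / 2 ^ n * (e ^ 2 * infDist p (range A)) := by simp only [r]; field_simp; ring
    _ ≤ e ^ 2 * infDist p (range A) := mul_le_of_le_one_left
        (mul_nonneg (sq_nonneg e) infDist_nonneg) (div_le_one_of_le₀ hn (by positivity))

end CenterClassification

section Residual
variable {X : Type*} [PseudoMetricSpace X] {e : ℝ} {s s' c : Set X} {a p t : X}

/-- The part of the cost of `p` for the centers `s` that is not accounted for by moving `p` to its
reference center `a`. It is set to `0` if `p` is so close to `a` that this part is negligible. -/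
def residual (e : ℝ) (s : Set X) (a p : X) : ℝ :=
  if e * infDist a s ≤ dist p a then infDist p s ^ 2 - infDist a s ^ 2 else 0

theorem abs_residual_le : |residual e s a p| ≤ 2 * infDist a s * dist p a + dist p a ^ 2 := by
  unfold residual
  split_ifs
  · exact abs_infDist_sq_sub_le
  · have : 0 ≤ infDist a s := infDist_nonneg
    rw [abs_zero]; positivity

theorem abs_residual_le_div (he : 0 < e) (he1 : e ≤ 1) :
    |residual e s a p| ≤ 3 / e * dist p a ^ 2 := by
  by_cases h : e * infDist a s ≤ dist p a
  · have hs : infDist a s ≤ dist p a / e := (le_div_iff₀' he).2 h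
    calc |residual e s a p| ≤ 2 * infDist a s * dist p a + dist p a ^ 2 := abs_residual_le
      _ ≤ 2 * (dist p a / e) * dist p a + dist p a ^ 2 / e := by
          gcongr; exact le_div_self (sq_nonneg _) he he1
      _ = 3 / e * dist p a ^ 2 := by ring
  · rw [residual, if_neg h, abs_zero]; positivity

theorem abs_infDist_sq_sub_residual_le (he : 0 ≤ e) (he1 : e ≤ 1) :
    |infDist p s ^ 2 - infDist a s ^ 2 - residual e s a p| ≤ 3 * e * infDist a s ^ 2 := by
  unfold residual
  split_ifs with h
  · rw [sub_self, abs_zero]; positivity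
  · have hs : 0 ≤ infDist a s := infDist_nonneg
    have hp : dist p a ≤ e * infDist a s := (not_le.1 h).le
    calc |infDist p s ^ 2 - infDist a s ^ 2 - 0|
        ≤ 2 * infDist a s * dist p a + dist p a ^ 2 := by rw [sub_zero]; exact abs_infDist_sq_sub_le
      _ ≤ 2 * infDist a s * (e * infDist a s) + (e * infDist a s) ^ 2 := by gcongr
      _ ≤ 3 * e * infDist a s ^ 2 := by nlinarith [mul_nonneg he (sq_nonneg (infDist a s))]

theorem abs_residual_le_of_lt (he : 0 ≤ e) (he1 : e ≤ 1) (h : dist p a < e * infDist a s') :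
    |residual e s a p| ≤ 3 * e * (infDist a s ^ 2 + infDist a s' ^ 2) := by
  have hs : 0 ≤ infDist a s := infDist_nonneg
  calc |residual e s a p| ≤ 2 * infDist a s * dist p a + dist p a ^ 2 := abs_residual_le
    _ ≤ 2 * infDist a s * (e * infDist a s') + (e * infDist a s') ^ 2 := by gcongr
    _ ≤ 3 * e * (infDist a s ^ 2 + infDist a s' ^ 2) := by
        nlinarith [mul_nonneg he (sq_nonneg (infDist a s - infDist a s')),
          mul_nonneg he (sq_nonneg (infDist a s)), mul_nonneg he (sq_nonneg (infDist a s'))]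

theorem infDist_le_of_mul_infDist_le (he : 0 < e) (he1 : e ≤ 1)
    (h : e * infDist a s ≤ dist p a) :
    infDist a s ≤ 2 * dist p a / e ∧ infDist p s ≤ 2 * dist p a / e := by
  have ha : infDist a s ≤ dist p a / e := (le_div_iff₀' he).2 h
  have hd : dist p a ≤ dist p a / e := le_div_self dist_nonneg he he1
  have hsplit : 2 * dist p a / e = dist p a / e + dist p a / e := by ring
  have hp : infDist p s ≤ infDist a s + dist p a := infDist_le_infDist_add_dist
  constructor <;> linarith [dist_nonneg (x := p) (y := a)]

theorem lt_dist_of_lt_mul_infDist (he : 0 < e) (he1 : e ≤ 1) (ha : a ∈ c)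
    (h : 3 * dist p a < e * infDist t c) :
    2 * dist p a / e < dist a t ∧ 2 * dist p a / e < dist p t := by
  have hd : dist p a ≤ dist p a / e := le_div_self dist_nonneg he he1
  have hsplit : 3 * dist p a / e = 2 * dist p a / e + dist p a / e := by ring
  have hat : 3 * dist p a / e < dist a t :=
    ((div_lt_iff₀' he).2 h).trans_le (dist_comm t a ▸ infDist_le_dist_of_mem ha)
  constructor <;> linarith [dist_nonneg (x := p) (y := a), dist_triangle_left a t p]

theorem abs_residual_sub_le {ι : Type*} [Finite ι] [Nonempty ι] {S S' : ι → X} (he : 0 < e)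
    (he1 : e ≤ 1) (ha : a ∈ c) (h : ∀ i, Interchangeable e (dist p a) c (S i) (S' i)) :
    |residual e (range S) a p - residual e (range S') a p| ≤
      3 * e * (infDist a (range S) ^ 2 + infDist a (range S') ^ 2) + 8 * e * dist p a ^ 2 := by
  have hrest : 0 ≤ 8 * e * dist p a ^ 2 := by positivity
  by_cases hS : e * infDist a (range S) ≤ dist p a
  swap
  · have hzero : residual e (range S) a p = 0 := if_neg hS
    rw [hzero, zero_sub, abs_neg, add_comm (infDist a (range S) ^ 2)]
    linarith [abs_residual_le_of_lt (s := range S') he.le he1 (not_le.1 hS)]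
  by_cases hS' : e * infDist a (range S') ≤ dist p a
  swap
  · have hzero : residual e (range S') a p = 0 := if_neg hS'
    rw [hzero, sub_zero]
    linarith [abs_residual_le_of_lt (s := range S) he.le he1 (not_le.1 hS')]
  obtain ⟨hSa, hSp⟩ := infDist_le_of_mul_infDist_le he he1 hS
  obtain ⟨hSa', hSp'⟩ := infDist_le_of_mul_infDist_le he he1 hS'
  have hfar := fun t => lt_dist_of_lt_mul_infDist (p := p) (t := t) he he1 ha
  have hdiffa := abs_infDist_range_sq_sub_le hSa hSa' fun i =>
    (h i).imp_right fun hi => ⟨(hfar _ hi.1).1, (hfar _ hi.2).1⟩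
  have hdiffp := abs_infDist_range_sq_sub_le hSp hSp' fun i =>
    (h i).imp_right fun hi => ⟨(hfar _ hi.1).2, (hfar _ hi.2).2⟩
  have hconst : 2 * (2 * dist p a / e) * (e ^ 2 * dist p a) = 4 * e * dist p a ^ 2 := by
    field_simp; ring
  rw [hconst] at hdiffa hdiffp
  have hmain : 0 ≤ 3 * e * (infDist a (range S) ^ 2 + infDist a (range S') ^ 2) := by positivity
  rw [residual, residual, if_pos hS, if_pos hS', sub_sub_sub_comm]
  linarith [abs_sub (infDist p (range S) ^ 2 - infDist p (range S') ^ 2)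
    (infDist a (range S) ^ 2 - infDist a (range S') ^ 2)]

end Residual

theorem cluster_card_pos {X : Type*} {k : ℕ} {P : Finset X} {σ : X → Fin k} {p : X} (hp : p ∈ P) :
    (0 : ℝ) < (cluster P σ (σ p)).card :=
  Nat.cast_pos.2 (Finset.card_pos.2 ⟨p, Finset.mem_filter.2 ⟨hp, rfl⟩⟩)

section Score
variable {X : Type*} [MetricSpace X] {k m : ℕ} {P : Finset X} {A : Fin k → X} {σ : X → Fin k}
  {p : X}

theorem avgCost_nonneg : 0 ≤ avgCost P A σ p :=
  div_nonneg (cost_nonneg _ A) (Nat.cast_nonneg _)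

theorem one_div_card_le_score :
    1 / (k * (cluster P σ (σ p)).card : ℝ) ≤ 4 * score P A σ p := by
  have hcluster := div_nonneg (pointCost_nonneg A p)
    (mul_nonneg k.cast_nonneg (cost_nonneg (cluster P σ (σ p)) A))
  have htotal := div_nonneg (pointCost_nonneg A p) (cost_nonneg P A)
  have havg := div_nonneg (avgCost_nonneg (P := P) (A := A) (σ := σ) (p := p)) (cost_nonneg P A)
  unfold score
  linarith

theorem pointCost_div_cost_le_score : pointCost A p / cost P A ≤ 4 * score P A σ p := by
  have hcard : 0 ≤ 1 / (k * (cluster P σ (σ p)).card : ℝ) := by positivity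
  have hcluster := div_nonneg (pointCost_nonneg A p)
    (mul_nonneg k.cast_nonneg (cost_nonneg (cluster P σ (σ p)) A))
  have havg := div_nonneg (avgCost_nonneg (P := P) (A := A) (σ := σ) (p := p)) (cost_nonneg P A)
  unfold score
  linarith

theorem score_pos (hp : p ∈ P) : 0 < score P A σ p := by
  have hk : (0 : ℝ) < k := Nat.cast_pos.2 (σ p).pos
  have hcard : 0 < 1 / (k * (cluster P σ (σ p)).card : ℝ) :=
    one_div_pos.2 (mul_pos hk (cluster_card_pos hp))
  linarith [one_div_card_le_score (P := P) (A := A) (σ := σ) (p := p)]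

theorem sum_cluster_score_le (P : Finset X) (A : Fin k → X) (σ : X → Fin k) (j : Fin k) :
    ∑ p ∈ cluster P σ j, score P A σ p
      ≤ 1 / 2 * (1 / k) + 1 / 2 * (cost (cluster P σ j) A / cost P A) := by
  set n : ℝ := ((cluster P σ j).card : ℝ)
  set c := cost (cluster P σ j) A
  have hc : 0 ≤ c / cost P A := div_nonneg (cost_nonneg _ A) (cost_nonneg P A)
  have hscore : ∀ p ∈ cluster P σ j, score P A σ p
      = 1 / 4 * (1 / (k * n) + pointCost A p * (1 / (k * c) + 1 / cost P A)
        + c / n / cost P A) := by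
    intro p hp
    simp only [score, avgCost, (Finset.mem_filter.1 hp).2, n, c]
    ring
  have hc_def : ∑ p ∈ cluster P σ j, pointCost A p = c := rfl
  calc ∑ p ∈ cluster P σ j, score P A σ p
      = 1 / 4 * (n * (1 / (k * n)) + c * (1 / (k * c) + 1 / cost P A)
          + n * (c / n / cost P A)) := by
        rw [Finset.sum_congr rfl hscore, ← Finset.mul_sum, Finset.sum_add_distrib,
          Finset.sum_add_distrib, ← Finset.sum_mul, hc_def, Finset.sum_const, Finset.sum_const,
          nsmul_eq_mul, nsmul_eq_mul]
    _ = 1 / 4 * (1 / k * (n / n) + 1 / k * (c / c) + c / cost P A + c / cost P A * (n / n)) := by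
        ring
    _ ≤ 1 / 4 * (1 / k * 1 + 1 / k * 1 + c / cost P A + c / cost P A * 1) := by
        gcongr <;> exact div_self_le_one _
    _ = 1 / 2 * (1 / k) + 1 / 2 * (c / cost P A) := by ring

theorem sum_score_le_one (P : Finset X) (A : Fin k → X) (σ : X → Fin k) :
    ∑ p ∈ P, score P A σ p ≤ 1 := by
  have htotal : ∑ j, cost (cluster P σ j) A = cost P A := Finset.sum_fiberwise P σ _
  calc ∑ p ∈ P, score P A σ p = ∑ j, ∑ p ∈ cluster P σ j, score P A σ p :=
        (Finset.sum_fiberwise P σ _).symm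
    _ ≤ ∑ j : Fin k, (1 / 2 * (1 / k) + 1 / 2 * (cost (cluster P σ j) A / cost P A)) :=
        Finset.sum_le_sum fun j _ => sum_cluster_score_le P A σ j
    _ = 1 / 2 * ((k : ℝ) / k) + 1 / 2 * (cost P A / cost P A) := by
        rw [Finset.sum_add_distrib, ← Finset.mul_sum, ← Finset.mul_sum, ← Finset.sum_div,
          ← Finset.sum_div, htotal]
        simp
    _ ≤ 1 := by linarith [div_self_le_one (k : ℝ), div_self_le_one (cost P A)]

theorem score_le_samplingProb (hp : p ∈ P) : score P A σ p ≤ samplingProb P A σ p := by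
  rw [samplingProb, le_div_iff₀ (Finset.sum_pos (fun x hx => score_pos hx) ⟨p, hp⟩)]
  exact mul_le_of_le_one_right (score_pos hp).le (sum_score_le_one P A σ)

theorem samplingProb_pos (hp : p ∈ P) : 0 < samplingProb P A σ p :=
  (score_pos hp).trans_le (score_le_samplingProb hp)

theorem sum_samplingProb (hP : P.Nonempty) : ∑ p : P, samplingProb P A σ p = 1 := by
  rw [Finset.sum_coe_sort P (samplingProb P A σ)]
  unfold samplingProb
  rw [← Finset.sum_div, div_self (Finset.sum_pos (fun x hx => score_pos hx) hP).ne']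

theorem one_le_card_mul_samplingProb (hp : p ∈ P) :
    1 ≤ 4 * k * (cluster P σ (σ p)).card * samplingProb P A σ p := by
  have hk : (0 : ℝ) < k := Nat.cast_pos.2 (σ p).pos
  have hscore := one_div_card_le_score (P := P) (A := A) (σ := σ) (p := p)
  rw [div_le_iff₀ (mul_pos hk (cluster_card_pos hp))] at hscore
  calc (1 : ℝ) ≤ 4 * k * (cluster P σ (σ p)).card * score P A σ p := by linarith
    _ ≤ 4 * k * (cluster P σ (σ p)).card * samplingProb P A σ p := by
        gcongr; exact score_le_samplingProb hp

theorem pointCost_le_mul_samplingProb (hp : p ∈ P) :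
    pointCost A p ≤ 4 * cost P A * samplingProb P A σ p := by
  have hle : pointCost A p ≤ cost P A :=
    Finset.single_le_sum (f := pointCost A) (fun q _ => pointCost_nonneg A q) hp
  calc pointCost A p = cost P A * (pointCost A p / cost P A) :=
        (mul_div_cancel_of_imp' fun h => (hle.trans h.le).antisymm (pointCost_nonneg A p)).symm
    _ ≤ cost P A * (4 * samplingProb P A σ p) := by
        refine mul_le_mul_of_nonneg_left ?_ (cost_nonneg P A)
        linarith [pointCost_div_cost_le_score (P := P) (A := A) (σ := σ) (p := p),
          score_le_samplingProb (A := A) (σ := σ) hp]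
    _ = 4 * cost P A * samplingProb P A σ p := by ring

open Classical in
/-- The total weight of the samples that hit the point `p`. This turns the weighted sample into a
weight function on `P`, so that its error is a sum over `P` with weights `empiricalWeight - 1`. -/
def empiricalWeight (P : Finset X) (A : Fin k → X) (σ : X → Fin k) (q : Fin m → P) (p : X) : ℝ :=
  ∑ i with (q i : X) = p, sampleWeight P A σ m (q i)

theorem empiricalWeight_nonneg (q : Fin m → P) (p : X) : 0 ≤ empiricalWeight P A σ q p :=
  Finset.sum_nonneg fun i _ =>
    one_div_nonneg.2 (mul_nonneg m.cast_nonneg (samplingProb_pos (q i).2).le)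

theorem sum_empiricalWeight_mul (q : Fin m → P) (f : X → ℝ) :
    ∑ p ∈ P, empiricalWeight P A σ q p * f p = ∑ i, sampleWeight P A σ m (q i) * f (q i) := by
  classical
  rw [← Finset.sum_fiberwise_of_maps_to (t := P) (g := fun i => (q i : X)) fun i _ => (q i).2]
  refine Finset.sum_congr rfl fun p _ => ?_
  rw [empiricalWeight, Finset.sum_mul]
  exact Finset.sum_congr (by congr) fun i hi => by rw [(Finset.mem_filter.1 hi).2]

theorem mul_sum_empiricalWeight_sub_one_mul (q : Fin m → P) (f : X → ℝ) :
    m * ∑ p ∈ P, (empiricalWeight P A σ q p - 1) * f p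
      = ∑ i, f (q i) / samplingProb P A σ (q i) - m * ∑ p : P, f p := by
  simp only [sub_mul, one_mul, Finset.sum_sub_distrib, mul_sub, sum_empiricalWeight_mul,
    Finset.sum_coe_sort P f, Finset.mul_sum]
  congr 1
  refine Finset.sum_congr rfl fun i _ => ?_
  have hm : (m : ℝ) ≠ 0 := Nat.cast_ne_zero.2 i.pos.ne'
  rw [sampleWeight, one_div_mul_eq_div, ← mul_div_assoc, mul_div_mul_left _ _ hm]

end Score

section Transfer
variable {X : Type*} [MetricSpace X] {k : ℕ} {e b γ B : ℝ} {P : Finset X} {A S S' : Fin k → X}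
  {σ : X → Fin k} {p : X} {Θ : Type*} {θ : X → Θ} {E : Θ → Finset X} {W : X → ℝ}

theorem sum_mul_comp_eq_sum_cluster {α : Type*} (P : Finset α) (σ : α → Fin k) (W : α → ℝ)
    (φ : Fin k → ℝ) :
    ∑ p ∈ P, W p * φ (σ p) = ∑ j, (∑ p ∈ cluster P σ j, W p) * φ j := by
  rw [← Finset.sum_fiberwise P σ]
  refine Finset.sum_congr rfl fun j _ => ?_
  rw [Finset.sum_mul]
  exact Finset.sum_congr rfl fun p hp => by rw [(Finset.mem_filter.1 hp).2]

theorem sum_infDist_center_sq_le (hγ : 1 ≤ γ) (hA : IsApproxSolution γ P A)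
    (hσ : IsNearestAssignment P A σ) (S : Fin k → X) :
    ∑ p ∈ P, infDist (A (σ p)) (range S) ^ 2 ≤ 4 * γ * cost P S := by
  have hpoint : ∀ p ∈ P,
      infDist (A (σ p)) (range S) ^ 2 ≤ 2 * pointCost S p + 2 * pointCost A p := by
    intro p hp
    have hle : infDist (A (σ p)) (range S) ≤ infDist p (range S) + dist p (A (σ p)) :=
      dist_comm p (A (σ p)) ▸ infDist_le_infDist_add_dist
    rw [← hσ.dist_sq_eq hp, pointCost_eq_infDist_sq]
    linarith [pow_le_pow_left₀ infDist_nonneg hle 2,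
      add_sq_le (a := infDist p (range S)) (b := dist p (A (σ p)))]
  calc ∑ p ∈ P, infDist (A (σ p)) (range S) ^ 2
      ≤ ∑ p ∈ P, (2 * pointCost S p + 2 * pointCost A p) := Finset.sum_le_sum hpoint
    _ = 2 * cost P S + 2 * cost P A := by
        rw [Finset.sum_add_distrib, ← Finset.mul_sum, ← Finset.mul_sum]; rfl
    _ ≤ 4 * γ * cost P S := by
        linarith [hA S, le_mul_of_one_le_left (cost_nonneg P S) hγ]

theorem sum_mul_infDist_center_sq_le (hγ : 1 ≤ γ) (hA : IsApproxSolution γ P A)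
    (hσ : IsNearestAssignment P A σ) (hB : 0 ≤ B)
    (hcluster : ∀ j, ∑ p ∈ cluster P σ j, W p ≤ B * (cluster P σ j).card) (S : Fin k → X) :
    ∑ p ∈ P, W p * infDist (A (σ p)) (range S) ^ 2 ≤ B * (4 * γ * cost P S) := by
  have hcenter := sum_mul_comp_eq_sum_cluster P σ (fun _ => 1) fun j =>
    infDist (A j) (range S) ^ 2
  simp only [one_mul, Finset.sum_const, nsmul_eq_mul, mul_one] at hcenter
  calc ∑ p ∈ P, W p * infDist (A (σ p)) (range S) ^ 2
      = ∑ j, (∑ p ∈ cluster P σ j, W p) * infDist (A j) (range S) ^ 2 :=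
        sum_mul_comp_eq_sum_cluster P σ W fun j => infDist (A j) (range S) ^ 2
    _ ≤ ∑ j, B * (cluster P σ j).card * infDist (A j) (range S) ^ 2 :=
        Finset.sum_le_sum fun j _ => mul_le_mul_of_nonneg_right (hcluster j) (sq_nonneg _)
    _ = B * ∑ p ∈ P, infDist (A (σ p)) (range S) ^ 2 := by
        simp only [hcenter, Finset.mul_sum, mul_assoc]
    _ ≤ B * (4 * γ * cost P S) :=
        mul_le_mul_of_nonneg_left (sum_infDist_center_sq_le hγ hA hσ S) hB

theorem abs_sum_mul_infDist_center_sq_le (hγ : 1 ≤ γ) (hA : IsApproxSolution γ P A)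
    (hσ : IsNearestAssignment P A σ) (hB : 0 ≤ B)
    (hcluster : ∀ j, |∑ p ∈ cluster P σ j, W p| ≤ B * (cluster P σ j).card) (S : Fin k → X) :
    |∑ p ∈ P, W p * infDist (A (σ p)) (range S) ^ 2| ≤ B * (4 * γ * cost P S) := by
  have hneg := sum_mul_infDist_center_sq_le (W := fun p => -W p) hγ hA hσ hB
    (fun j => (Finset.sum_neg_distrib W).trans_le ((neg_le_abs _).trans (hcluster j))) S
  simp only [neg_mul, Finset.sum_neg_distrib] at hneg
  exact abs_le'.2
    ⟨sum_mul_infDist_center_sq_le hγ hA hσ hB (fun j => (le_abs_self _).trans (hcluster j)) S, hneg⟩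

/-- The error that is left of the cost of `p` for the centers `S` after moving `p` to its reference
center `a` and correcting by the residual for the centers `S'`. -/
def remainder (e : ℝ) (S S' : Fin k → X) (a p : X) : ℝ :=
  pointCost S p - infDist a (range S) ^ 2 - residual e (range S') a p

theorem IsCenterClassification.abs_remainder_le (hθ : IsCenterClassification e b P A θ E)
    (hσ : IsNearestAssignment P A σ) (he : 0 < e) (he1 : e ≤ 1)
    (hSS : ∀ l, θ (S l) = θ (S' l)) (hp : p ∈ P) :
    |remainder e S S' (A (σ p)) p|
      ≤ 3 * e * (2 * infDist (A (σ p)) (range S) ^ 2 + infDist (A (σ p)) (range S') ^ 2)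
        + 8 * e * pointCost A p
        + 6 / e * ∑ l, (E (θ (S l)) : Set X).indicator (pointCost A) p := by
  set a := A (σ p)
  have hindicator : ∀ l, 0 ≤ (E (θ (S l)) : Set X).indicator (pointCost A) p := fun l =>
    indicator_apply_nonneg fun _ => pointCost_nonneg A p
  have hsplit : |remainder e S S' a p| ≤ 3 * e * infDist a (range S) ^ 2
      + |residual e (range S) a p - residual e (range S') a p| := by
    rw [remainder, pointCost_eq_infDist_sq]
    exact (abs_sub_le _ (residual e (range S) a p) _).trans
      (by linarith [abs_infDist_sq_sub_residual_le (s := range S) (a := a) (p := p) he.le he1])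
  rw [← hσ.dist_sq_eq hp] at *
  by_cases hexceptional : ∃ l, p ∈ E (θ (S l))
  · obtain ⟨l, hl⟩ := hexceptional
    have hsingle := Finset.single_le_sum (fun l _ => hindicator l) (Finset.mem_univ l)
    rw [indicator_of_mem (Finset.mem_coe.2 hl), ← hσ.dist_sq_eq hp] at hsingle
    have hresidual : |residual e (range S) a p - residual e (range S') a p|
        ≤ 6 / e * ∑ l, (E (θ (S l)) : Set X).indicator (pointCost A) p :=
      calc |residual e (range S) a p - residual e (range S') a p|
          ≤ |residual e (range S) a p| + |residual e (range S') a p| := abs_sub _ _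
        _ ≤ 3 / e * dist p a ^ 2 + 3 / e * dist p a ^ 2 := add_le_add
            (abs_residual_le_div he he1) (abs_residual_le_div he he1)
        _ = 6 / e * dist p a ^ 2 := by ring
        _ ≤ _ := by gcongr
    have hcenter : 0 ≤ 3 * e * (infDist a (range S) ^ 2 + infDist a (range S') ^ 2) := by positivity
    have hcost : 0 ≤ 8 * e * dist p a ^ 2 := by positivity
    linarith
  · have : Nonempty (Fin k) := ⟨σ p⟩
    have hresidual := abs_residual_sub_le (p := p) he he1 (mem_range_self (σ p)) fun l =>
      hσ.dist_eq hp ▸ hθ.interchangeable (hSS l) p hp fun hl => hexceptional ⟨l, hl⟩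
    have hsum : 0 ≤ 6 / e * ∑ l, (E (θ (S l)) : Set X).indicator (pointCost A) p :=
      mul_nonneg (by positivity) (Finset.sum_nonneg fun l _ => hindicator l)
    linarith

theorem IsCenterClassification.sum_mul_indicator_le (hθ : IsCenterClassification e b P A θ E)
    (hexceptional : ∀ a, ∑ p ∈ E a, W p * pointCost A p ≤ B) (S : Fin k → X) :
    ∑ p ∈ P, W p * ∑ l, (E (θ (S l)) : Set X).indicator (pointCost A) p ≤ k * B := by
  simp only [Finset.mul_sum]
  rw [Finset.sum_comm]
  calc ∑ l, ∑ p ∈ P, W p * (E (θ (S l)) : Set X).indicator (pointCost A) p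
      = ∑ l, ∑ p ∈ E (θ (S l)), W p * pointCost A p := Finset.sum_congr rfl fun l _ => by
        rw [← Finset.sum_indicator_subset _ (hθ.subset (θ (S l)))]
        simp only [indicator_mul_right]
    _ ≤ ∑ _l : Fin k, B := Finset.sum_le_sum fun l _ => hexceptional _
    _ = k * B := by simp

theorem IsCenterClassification.sum_mul_abs_remainder_le [NeZero k]
    (hθ : IsCenterClassification e b P A θ E) (hγ : 1 ≤ γ) (hA : IsApproxSolution γ P A)
    (hσ : IsNearestAssignment P A σ) (he : 0 < e) (he1 : e ≤ 1) (hB : 0 ≤ B)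
    (hW : ∀ p, 0 ≤ W p) (hcluster : ∀ j, ∑ p ∈ cluster P σ j, W p ≤ B * (cluster P σ j).card)
    (hcost : ∑ p ∈ P, W p * pointCost A p ≤ B * cost P A)
    (hexceptional : ∀ a, ∑ p ∈ E a, W p * pointCost A p ≤ B * (e ^ 2 / k * cost P A))
    (hSS : ∀ l, θ (S l) = θ (S' l)) (hSS' : cost P S' ≤ 2 * cost P S) :
    ∑ p ∈ P, W p * |remainder e S S' (A (σ p)) p| ≤ B * (62 * γ * e * cost P S) := by
  have hk : (k : ℝ) ≠ 0 := Nat.cast_ne_zero.2 (NeZero.ne k)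
  have hsum := Finset.sum_le_sum fun p hp =>
    mul_le_mul_of_nonneg_left (hθ.abs_remainder_le hσ he he1 hSS hp) (hW p)
  calc ∑ p ∈ P, W p * |remainder e S S' (A (σ p)) p|
      ≤ 6 * e * ∑ p ∈ P, W p * infDist (A (σ p)) (range S) ^ 2
        + 3 * e * ∑ p ∈ P, W p * infDist (A (σ p)) (range S') ^ 2
        + 8 * e * ∑ p ∈ P, W p * pointCost A p
        + 6 / e * ∑ p ∈ P, W p * ∑ l, (E (θ (S l)) : Set X).indicator (pointCost A) p := by
        refine hsum.trans_eq ?_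
        simp only [Finset.mul_sum (s := P), ← Finset.sum_add_distrib]
        exact Finset.sum_congr rfl fun p _ => by ring
    _ ≤ 6 * e * (B * (4 * γ * cost P S)) + 3 * e * (B * (4 * γ * cost P S'))
        + 8 * e * (B * cost P A) + 6 / e * (k * (B * (e ^ 2 / k * cost P A))) := by
        gcongr
        · exact sum_mul_infDist_center_sq_le hγ hA hσ hB hcluster S
        · exact sum_mul_infDist_center_sq_le hγ hA hσ hB hcluster S'
        · exact hθ.sum_mul_indicator_le hexceptional S
    _ = B * (24 * γ * e * cost P S + 12 * γ * e * cost P S' + 14 * e * cost P A) := by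
        field_simp; ring
    _ ≤ B * (24 * γ * e * cost P S + 12 * γ * e * (2 * cost P S) + 14 * e * (γ * cost P S)) := by
        gcongr
        exact hA S
    _ = B * (62 * γ * e * cost P S) := by ring

/-- The weights `W` estimate the sizes of the clusters with relative error `e`, the cost of `P` for
`A` up to a factor `2`, and the cost of each exceptional set `E a` up to `e ^ 2 / k` times the cost
of `P`. -/
structure IsAccurateWeight (e : ℝ) (P : Finset X) (A : Fin k → X) (σ : X → Fin k)
    (E : Θ → Finset X) (W : X → ℝ) : Prop where
  nonneg : ∀ p, 0 ≤ W p
  abs_card_le : ∀ j, |∑ p ∈ cluster P σ j, (W p - 1)| ≤ e * (cluster P σ j).card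
  abs_cost_le : |∑ p ∈ P, (W p - 1) * pointCost A p| ≤ cost P A
  abs_exceptional_le : ∀ a, |∑ p ∈ E a, (W p - 1) * pointCost A p| ≤ e ^ 2 / k * cost P A

theorem IsCenterClassification.abs_sum_sub_one_mul_remainder_le [NeZero k]
    (hθ : IsCenterClassification e (e ^ 2 / k * cost P A) P A θ E) (hγ : 1 ≤ γ)
    (hA : IsApproxSolution γ P A) (hσ : IsNearestAssignment P A σ) (he : 0 < e) (he1 : e ≤ 1)
    (hW : IsAccurateWeight e P A σ E W)
    (hSS : ∀ l, θ (S l) = θ (S' l)) (hSS' : cost P S' ≤ 2 * cost P S) :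
    |∑ p ∈ P, (W p - 1) * remainder e S S' (A (σ p)) p| ≤ 186 * γ * e * cost P S := by
  have hadd : ∀ (F : Finset X) (f : X → ℝ),
      ∑ p ∈ F, (W p + 1) * f p = ∑ p ∈ F, (W p - 1) * f p + 2 * ∑ p ∈ F, f p := fun F f => by
    rw [Finset.mul_sum, ← Finset.sum_add_distrib]
    exact Finset.sum_congr rfl fun p _ => by ring
  calc |∑ p ∈ P, (W p - 1) * remainder e S S' (A (σ p)) p|
      ≤ ∑ p ∈ P, |(W p - 1) * remainder e S S' (A (σ p)) p| := Finset.abs_sum_le_sum_abs _ _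
    _ ≤ ∑ p ∈ P, (W p + 1) * |remainder e S S' (A (σ p)) p| :=
        Finset.sum_le_sum fun p _ => (abs_mul _ _).trans_le <| mul_le_mul_of_nonneg_right
          (abs_le.2 (by constructor <;> linarith [hW.nonneg p])) (abs_nonneg _)
    _ ≤ 3 * (62 * γ * e * cost P S) := by
        refine hθ.sum_mul_abs_remainder_le hγ hA hσ he he1 zero_le_three
          (fun p => by linarith [hW.nonneg p]) (fun j => ?_) ?_ (fun a => ?_) hSS hSS'
        · have hcard := hadd (cluster P σ j) fun _ => 1
          simp only [mul_one, Finset.sum_const, nsmul_eq_mul] at hcard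
          linarith [le_of_abs_le (hW.abs_card_le j),
            mul_le_of_le_one_left (Nat.cast_nonneg (α := ℝ) (cluster P σ j).card) he1]
        · have hcostA : ∑ p ∈ P, pointCost A p = cost P A := rfl
          linarith [hadd P (pointCost A), le_of_abs_le hW.abs_cost_le]
        · have hcostE : ∑ p ∈ E a, pointCost A p ≤ e ^ 2 / k * cost P A := hθ.cost_le a
          linarith [hadd (E a) (pointCost A), le_of_abs_le (hW.abs_exceptional_le a)]
    _ = 186 * γ * e * cost P S := by ring

theorem IsCenterClassification.abs_sum_sub_one_mul_pointCost_le [NeZero k]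
    (hθ : IsCenterClassification e (e ^ 2 / k * cost P A) P A θ E) (hγ : 1 ≤ γ)
    (hA : IsApproxSolution γ P A) (hσ : IsNearestAssignment P A σ) (he : 0 < e) (he1 : e ≤ 1)
    (hW : IsAccurateWeight e P A σ E W)
    (hSS : ∀ l, θ (S l) = θ (S' l)) (hSS' : cost P S' ≤ 2 * cost P S)
    (hresidual : |∑ p ∈ P, (W p - 1) * residual e (range S') (A (σ p)) p| ≤ e * cost P S') :
    |∑ p ∈ P, (W p - 1) * pointCost S p| ≤ 192 * γ * e * cost P S := by
  have hcenter := abs_sum_mul_infDist_center_sq_le hγ hA hσ he.le hW.abs_card_le S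
  have hremainder := hθ.abs_sum_sub_one_mul_remainder_le hγ hA hσ he he1 hW hSS hSS'
  have hsplit : ∑ p ∈ P, (W p - 1) * pointCost S p
      = ∑ p ∈ P, (W p - 1) * infDist (A (σ p)) (range S) ^ 2
        + ∑ p ∈ P, (W p - 1) * residual e (range S') (A (σ p)) p
        + ∑ p ∈ P, (W p - 1) * remainder e S S' (A (σ p)) p := by
    simp only [← Finset.sum_add_distrib, remainder]
    exact Finset.sum_congr rfl fun p _ => by ring
  have hSγ : e * cost P S ≤ γ * (e * cost P S) :=
    le_mul_of_one_le_left (mul_nonneg he.le (cost_nonneg P S)) hγ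
  calc |∑ p ∈ P, (W p - 1) * pointCost S p|
      ≤ e * (4 * γ * cost P S) + e * (2 * cost P S) + 186 * γ * e * cost P S := by
        rw [hsplit]
        refine (abs_add_three _ _ _).trans
          (add_le_add_three hcenter (hresidual.trans ?_) hremainder)
        gcongr
    _ ≤ 192 * γ * e * cost P S := by linarith

end Transfer

section Tails
variable {X : Type*} [MetricSpace X] {k m : ℕ} {b c e l t T V γ : ℝ} {P E : Finset X}
  {A : Fin k → X} {σ : X → Fin k} {f : X → ℝ}

theorem sampleProbability_eq_productProb (F : Set (Fin m → P)) :
    sampleProbability P A σ m F = productProb (fun p : P => samplingProb P A σ p) m F :=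
  rfl

theorem sampleProbability_abs_tail_le (hP : P.Nonempty) (hl : 0 ≤ l)
    (hf : ∀ p ∈ P, |l * f p| ≤ samplingProb P A σ p)
    (hV : ∑ p ∈ P, f p ^ 2 / samplingProb P A σ p ≤ V) (ht : l * V ≤ t / 2) :
    sampleProbability P A σ m {q | t < |∑ p ∈ P, (empiricalWeight P A σ q p - 1) * f p|}
      ≤ 2 * Real.exp (-(m * (l * t / 2))) := by
  have hμ : ∀ p : P, 0 ≤ samplingProb P A σ p := fun p => (samplingProb_pos p.2).le
  have hsub : {q : Fin m → P | t < |∑ p ∈ P, (empiricalWeight P A σ q p - 1) * f p|} ⊆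
      {q | m * l * t ≤ |∑ i, l * f (q i) / samplingProb P A σ (q i) - m * ∑ p : P, l * f p|} := by
    intro q hq
    have hq' : t < |∑ p ∈ P, (empiricalWeight P A σ q p - 1) * f p| := hq
    change m * l * t ≤ |∑ i, l * f (q i) / samplingProb P A σ (q i) - m * ∑ p : P, l * f p|
    calc m * l * t ≤ m * l * |∑ p ∈ P, (empiricalWeight P A σ q p - 1) * f p| := by gcongr
      _ = |∑ i, l * f (q i) / samplingProb P A σ (q i) - m * ∑ p : P, l * f p| := by
        rw [← mul_sum_empiricalWeight_sub_one_mul q fun p => l * f p]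
        simp only [mul_left_comm _ l, ← Finset.mul_sum, abs_mul, abs_of_nonneg hl, Nat.abs_cast]
        ring
  have hvariance : ∑ p : P, (l * f p) ^ 2 / samplingProb P A σ p ≤ l * (t / 2) :=
    calc ∑ p : P, (l * f p) ^ 2 / samplingProb P A σ p
        = l * (l * ∑ p ∈ P, f p ^ 2 / samplingProb P A σ p) := by
          rw [Finset.sum_coe_sort P fun p => (l * f p) ^ 2 / samplingProb P A σ p]
          simp only [Finset.mul_sum]
          exact Finset.sum_congr rfl fun p _ => by ring
      _ ≤ l * (t / 2) := by gcongr; exact (mul_le_mul_of_nonneg_left hV hl).trans ht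
  refine (productProb_mono hμ hsub).trans ((productProb_abs_tail_le hμ (sum_samplingProb hP)
    (fun p => hf p p.2) _).trans ?_)
  gcongr
  linarith [mul_le_mul_of_nonneg_left hvariance (Nat.cast_nonneg (α := ℝ) m)]

theorem sampleProbability_abs_tail_le_of_nonneg (hP : P.Nonempty) (hEP : E ⊆ P)
    (hf : ∀ p ∈ E, 0 ≤ f p) (hc : 0 < c) (hT : 0 < T) (he : 0 ≤ e) (he1 : e ≤ 1)
    (hfμ : ∀ p ∈ E, c * f p ≤ T * samplingProb P A σ p) (hsum : ∑ p ∈ E, f p ≤ T) :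
    sampleProbability P A σ m {q | e * T < |∑ p ∈ E, (empiricalWeight P A σ q p - 1) * f p|}
      ≤ 2 * Real.exp (-(m * (e ^ 2 * c / 4))) := by
  classical
  have hrestrict : ∀ q : Fin m → P, ∑ p ∈ E, (empiricalWeight P A σ q p - 1) * f p
      = ∑ p ∈ P, (empiricalWeight P A σ q p - 1) * (E : Set X).indicator f p := fun q => by
    rw [← Finset.sum_indicator_subset _ hEP]
    simp only [indicator_mul_right]
  have hindicator : ∀ p ∈ P, |e * c / (2 * T) * (E : Set X).indicator f p|
      ≤ samplingProb P A σ p := by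
    intro p hp
    by_cases hpE : p ∈ E
    · rw [indicator_of_mem (Finset.mem_coe.2 hpE),
        abs_of_nonneg (mul_nonneg (by positivity) (hf p hpE)), div_mul_eq_mul_div,
        div_le_iff₀ (by positivity)]
      nlinarith [hfμ p hpE, mul_nonneg hc.le (hf p hpE), mul_pos hT (samplingProb_pos
        (A := A) (σ := σ) hp)]
    · rw [indicator_of_notMem (Finset.mem_coe.not.2 hpE), mul_zero, abs_zero]
      exact (samplingProb_pos hp).le
  have hvariance : ∑ p ∈ P, (E : Set X).indicator f p ^ 2 / samplingProb P A σ p ≤ T ^ 2 / c :=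
    calc ∑ p ∈ P, (E : Set X).indicator f p ^ 2 / samplingProb P A σ p
        = ∑ p ∈ E, f p ^ 2 / samplingProb P A σ p := by
          rw [← Finset.sum_indicator_subset _ hEP]
          refine Finset.sum_congr rfl fun p _ => ?_
          by_cases hpE : p ∈ E <;> simp [hpE]
      _ ≤ ∑ p ∈ E, T / c * f p := Finset.sum_le_sum fun p hp => by
          rw [div_mul_eq_mul_div, div_le_div_iff₀ (samplingProb_pos (hEP hp)) hc]
          nlinarith [mul_le_mul_of_nonneg_left (hfμ p hp) (hf p hp)]
      _ ≤ T / c * T := by rw [← Finset.mul_sum]; gcongr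
      _ = T ^ 2 / c := by ring
  simp only [hrestrict]
  refine (sampleProbability_abs_tail_le hP (by positivity) hindicator hvariance
    (le_of_eq ?_)).trans_eq ?_
  · field_simp
  · congr 3
    field_simp
    norm_num

theorem sampleProbability_cluster_card_tail_le (hP : P.Nonempty) (he : 0 ≤ e) (he1 : e ≤ 1)
    (j : Fin k) :
    sampleProbability P A σ m {q | e * (cluster P σ j).card
        < |∑ p ∈ cluster P σ j, (empiricalWeight P A σ q p - 1)|}
      ≤ 2 * Real.exp (-(m * (e ^ 2 / (16 * k)))) := by
  have hk : (0 : ℝ) < k := Nat.cast_pos.2 j.pos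
  rcases (cluster P σ j).eq_empty_or_nonempty with hempty | hnonempty
  · simp [hempty, sampleProbability, Real.exp_nonneg]
  have htail := sampleProbability_abs_tail_le_of_nonneg (A := A) (σ := σ) (m := m)
    (E := cluster P σ j) (f := fun _ => 1) (c := 1 / (4 * k)) (T := (cluster P σ j).card)
    hP (Finset.filter_subset _ _) (fun _ _ => zero_le_one) (by positivity)
    (Nat.cast_pos.2 hnonempty.card_pos) he he1 (fun p hp => ?_) (by simp)
  · simp only [mul_one] at htail
    refine htail.trans_eq ?_
    congr 3
    field_simp
    norm_num
  · obtain ⟨hpP, rfl⟩ := Finset.mem_filter.1 hp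
    rw [mul_one, div_le_iff₀ (by positivity)]
    linarith [one_le_card_mul_samplingProb (A := A) (σ := σ) hpP]

theorem sampleProbability_cost_tail_le (hP : P.Nonempty) (hcA : 0 < cost P A) (hEP : E ⊆ P)
    (hb : 0 < b) (hE : cost E A ≤ b * cost P A) :
    sampleProbability P A σ m {q | b * cost P A
        < |∑ p ∈ E, (empiricalWeight P A σ q p - 1) * pointCost A p|}
      ≤ 2 * Real.exp (-(m * (b / 16))) := by
  have htail := sampleProbability_abs_tail_le_of_nonneg (A := A) (σ := σ) (m := m)
    (f := pointCost A) (c := b / 4) hP hEP (fun p _ => pointCost_nonneg A p) (by positivity)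
    (mul_pos hb hcA) zero_le_one le_rfl (fun p hp => ?_) hE
  · simp only [one_mul] at htail
    refine htail.trans_eq ?_
    congr 3
    ring
  · linarith [mul_le_mul_of_nonneg_left
      (pointCost_le_mul_samplingProb (A := A) (σ := σ) (hEP hp)) hb.le]

theorem residual_sq_div_samplingProb_le (hσ : IsNearestAssignment P A σ) (S : Fin k → X) {p : X}
    (hp : p ∈ P) :
    residual e (range S) (A (σ p)) p ^ 2 / samplingProb P A σ p
      ≤ 4 * cost P A * (8 * infDist (A (σ p)) (range S) ^ 2 + 2 * pointCost A p) := by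
  rw [div_le_iff₀ (samplingProb_pos hp)]
  set d := infDist (A (σ p)) (range S)
  set r := dist p (A (σ p))
  have hr : r ^ 2 = pointCost A p := hσ.dist_sq_eq hp
  calc residual e (range S) (A (σ p)) p ^ 2 ≤ (2 * d * r + r ^ 2) ^ 2 :=
        sq_le_sq.2 (abs_residual_le.trans (le_abs_self _))
    _ ≤ (8 * d ^ 2 + 2 * r ^ 2) * r ^ 2 := by linarith [sq_nonneg ((2 * d - r) * r)]
    _ ≤ (8 * d ^ 2 + 2 * r ^ 2) * (4 * cost P A * samplingProb P A σ p) := by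
        gcongr
        exact hr.trans_le (pointCost_le_mul_samplingProb hp)
    _ = 4 * cost P A * (8 * d ^ 2 + 2 * pointCost A p) * samplingProb P A σ p := by
        rw [hr]; ring

theorem sum_residual_sq_div_samplingProb_le (hγ : 1 ≤ γ) (hA : IsApproxSolution γ P A)
    (hσ : IsNearestAssignment P A σ) (S : Fin k → X) :
    ∑ p ∈ P, residual e (range S) (A (σ p)) p ^ 2 / samplingProb P A σ p
      ≤ 136 * γ ^ 2 * cost P S ^ 2 := by
  have hcost : ∑ p ∈ P, pointCost A p = cost P A := rfl
  have hS := cost_nonneg P S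
  calc ∑ p ∈ P, residual e (range S) (A (σ p)) p ^ 2 / samplingProb P A σ p
      ≤ ∑ p ∈ P, 4 * cost P A * (8 * infDist (A (σ p)) (range S) ^ 2 + 2 * pointCost A p) :=
        Finset.sum_le_sum fun p hp => residual_sq_div_samplingProb_le hσ S hp
    _ = 4 * cost P A * (8 * ∑ p ∈ P, infDist (A (σ p)) (range S) ^ 2 + 2 * cost P A) := by
        rw [← Finset.mul_sum, Finset.sum_add_distrib, ← Finset.mul_sum, ← Finset.mul_sum, hcost]
    _ ≤ 4 * (γ * cost P S) * (8 * (4 * γ * cost P S) + 2 * (γ * cost P S)) := by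
        have hA0 := cost_nonneg P A
        gcongr
        · exact hA S
        · exact sum_infDist_center_sq_le hγ hA hσ S
        · exact hA S
    _ = 136 * γ ^ 2 * cost P S ^ 2 := by ring

theorem sampleProbability_residual_tail_le (hP : P.Nonempty) (hγ : 1 ≤ γ) (he : 0 < e)
    (he1 : e ≤ 1) (hA : IsApproxSolution γ P A) (hσ : IsNearestAssignment P A σ)
    (hcA : 0 < cost P A) (S : Fin k → X) :
    sampleProbability P A σ m {q | e * cost P S
        < |∑ p ∈ P, (empiricalWeight P A σ q p - 1) * residual e (range S) (A (σ p)) p|}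
      ≤ 2 * Real.exp (-(m * (e ^ 2 / (544 * γ ^ 2)))) := by
  have hγ0 : 0 < γ := zero_lt_one.trans_le hγ
  have hS : 0 < cost P S := pos_of_mul_pos_right (hcA.trans_le (hA S)) hγ0.le
  refine (sampleProbability_abs_tail_le (l := e / (272 * γ ^ 2 * cost P S)) hP (by positivity)
    (fun p hp => ?_) (sum_residual_sq_div_samplingProb_le hγ hA hσ S) (le_of_eq ?_)).trans_eq ?_
  · have hμ := (samplingProb_pos (A := A) (σ := σ) hp).le
    rw [abs_mul, abs_of_pos (by positivity), div_mul_eq_mul_div, div_le_iff₀ (by positivity)]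
    calc e * |residual e (range S) (A (σ p)) p| ≤ e * (3 / e * pointCost A p) := by
          gcongr
          exact hσ.dist_sq_eq hp ▸ abs_residual_le_div he he1
      _ = 3 * pointCost A p := by field_simp
      _ ≤ 3 * (4 * (γ * cost P S) * samplingProb P A σ p) := by
          gcongr
          refine (pointCost_le_mul_samplingProb (σ := σ) hp).trans ?_
          gcongr
          exact hA S
      _ = samplingProb P A σ p * cost P S * (12 * γ) := by ring
      _ ≤ samplingProb P A σ p * cost P S * (272 * γ ^ 2) := by
          gcongr
          · norm_num
          · exact le_self_pow₀ hγ two_ne_zero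
      _ = samplingProb P A σ p * (272 * γ ^ 2 * cost P S) := by ring
  · field_simp
    norm_num
  · congr 3
    field_simp
    ring

end Tails

theorem exists_representative {α Ξ : Type*} [Nonempty α] (θ : α → Ξ) {F : α → ℝ} {b : ℝ}
    (hb : 0 < b) (hF : ∀ x, b ≤ F x) :
    ∃ rep : Ξ → α, ∀ x, θ (rep (θ x)) = θ x ∧ F (rep (θ x)) ≤ 2 * F x := by
  have hclass : ∀ a, ∃ y, ∀ x, θ x = a → θ y = a ∧ F y ≤ 2 * F x := by
    intro a
    rcases isEmpty_or_nonempty {x // θ x = a} with hempty | hnonempty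
    · exact ⟨Classical.arbitrary α, fun x hx => hempty.elim ⟨x, hx⟩⟩
    · have hbdd : BddBelow (range fun x : {x // θ x = a} => F x) :=
        ⟨b, by rintro _ ⟨x, rfl⟩; exact hF x⟩
      have hinf : b ≤ ⨅ x : {x // θ x = a}, F x := le_ciInf fun x => hF x
      obtain ⟨⟨y, hy⟩, hlt⟩ := exists_lt_of_ciInf_lt
        (show ⨅ x : {x // θ x = a}, F x < 2 * ⨅ x : {x // θ x = a}, F x by linarith)
      exact ⟨y, fun x hx => ⟨hy, hlt.le.trans (by gcongr; exact ciInf_le hbdd ⟨x, hx⟩)⟩⟩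
  choose rep hrep using hclass
  exact ⟨rep, fun x => hrep (θ x) x rfl⟩

section Failure
variable {X : Type*} [MetricSpace X] {D k m N n : ℕ} {e γ ε : ℝ} {P : Finset X} {A : Fin k → X}
  {σ : X → Fin k} {Θ : Type*} {θ : X → Θ} {E : Θ → Finset X}

theorem isCoreset_iff_abs_sum_empiricalWeight_le {q : Fin m → P} :
    IsCoreset k ε P (fun i => (q i : X)) (fun i => sampleWeight P A σ m (q i)) ↔
      ∀ S : Fin k → X,
        |∑ p ∈ P, (empiricalWeight P A σ q p - 1) * pointCost S p| ≤ ε * cost P S := by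
  simp only [IsCoreset, sub_mul, one_mul, Finset.sum_sub_distrib, sum_empiricalWeight_mul, cost]

theorem sampleProbability_not_isAccurateWeight_le [Fintype Θ] (hP : P.Nonempty)
    (hcA : 0 < cost P A) (he : 0 < e) (he1 : e ≤ 1)
    (hθ : IsCenterClassification e (e ^ 2 / k * cost P A) P A θ E) :
    sampleProbability P A σ m {q | ¬IsAccurateWeight e P A σ E (empiricalWeight P A σ q)}
      ≤ (k + 1 + Fintype.card Θ) * (2 * Real.exp (-(m * (e ^ 2 / (16 * k))))) := by
  obtain ⟨p₀, -⟩ := id hP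
  have hk : 1 ≤ (k : ℝ) := Nat.one_le_cast.2 (σ p₀).pos
  have hμ : ∀ p : P, 0 ≤ samplingProb P A σ p := fun p => (samplingProb_pos p.2).le
  let failCluster : Fin k → Set (Fin m → P) := fun j => {q | e * (cluster P σ j).card
    < |∑ p ∈ cluster P σ j, (empiricalWeight P A σ q p - 1)|}
  let failCost : ℝ → Finset X → Set (Fin m → P) := fun b F => {q | b * cost P A
    < |∑ p ∈ F, (empiricalWeight P A σ q p - 1) * pointCost A p|}
  have hcluster := productProb_iUnion_le_card_mul (E := failCluster) hμ fun j =>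
    sampleProbability_cluster_card_tail_le hP he.le he1 j
  have htotal := sampleProbability_cost_tail_le (σ := σ) (m := m) hP hcA subset_rfl one_pos
    (one_mul (cost P A)).ge
  have hexceptional := productProb_iUnion_le_card_mul (E := fun a => failCost (e ^ 2 / k) (E a)) hμ
    fun a => sampleProbability_cost_tail_le hP hcA (hθ.subset a) (by positivity) (hθ.cost_le a)
  have hexp : Real.exp (-(m * (1 / 16 : ℝ))) ≤ Real.exp (-(m * (e ^ 2 / (16 * k)))) := by
    have hdiv : e ^ 2 / (16 * k) ≤ 1 / 16 := by
      rw [div_le_div_iff₀ (by positivity) (by norm_num)]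
      linarith [pow_le_one₀ he.le he1 (n := 2)]
    exact Real.exp_le_exp.2 (neg_le_neg (mul_le_mul_of_nonneg_left hdiv m.cast_nonneg))
  rw [Fintype.card_fin] at hcluster
  rw [div_div, mul_comm (k : ℝ) 16] at hexceptional
  have hsub : {q | ¬IsAccurateWeight e P A σ E (empiricalWeight P A σ q)}
      ⊆ (⋃ j, failCluster j) ∪ failCost 1 P ∪ ⋃ a, failCost (e ^ 2 / k) (E a) := by
    intro q hq
    by_contra hfail
    simp only [mem_union, mem_iUnion, not_or, not_exists] at hfail
    obtain ⟨⟨hfailCluster, hfailCost⟩, hfailExceptional⟩ := hfail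
    exact hq ⟨empiricalWeight_nonneg q, fun j => not_lt.1 (hfailCluster j),
      (not_lt.1 hfailCost).trans_eq (one_mul _), fun a => not_lt.1 (hfailExceptional a)⟩
  have hunion := productProb_union_le hμ ((⋃ j, failCluster j) ∪ failCost 1 P)
    (⋃ a, failCost (e ^ 2 / k) (E a))
  have hunion' := productProb_union_le hμ (⋃ j, failCluster j) (failCost 1 P)
  rw [sampleProbability_eq_productProb] at *
  linarith [productProb_mono hμ hsub]

theorem one_sub_le_sampleProbability_of_isCenterClassification [NeZero k] [Fintype Θ]
    (hP : P.Nonempty) (hγ : 1 ≤ γ) (he : 0 < e) (he1 : e ≤ 1) (hA : IsApproxSolution γ P A)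
    (hσ : IsNearestAssignment P A σ) (hcA : 0 < cost P A)
    (hθ : IsCenterClassification e (e ^ 2 / k * cost P A) P A θ E) :
    1 - ((k + 1 + Fintype.card Θ) * (2 * Real.exp (-(m * (e ^ 2 / (16 * k)))))
        + (Fintype.card Θ : ℝ) ^ k * (2 * Real.exp (-(m * (e ^ 2 / (544 * γ ^ 2))))))
      ≤ sampleProbability P A σ m {q | IsCoreset k (192 * γ * e) P (fun i => (q i : X))
          (fun i => sampleWeight P A σ m (q i))} := by
  classical
  have hμ : ∀ p : P, 0 ≤ samplingProb P A σ p := fun p => (samplingProb_pos p.2).le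
  have hγ0 : 0 < γ := zero_lt_one.trans_le hγ
  have : Nonempty (Fin k → X) := ⟨A⟩
  obtain ⟨rep, hrep⟩ := exists_representative (fun (S : Fin k → X) l => θ (S l))
    (div_pos hcA hγ0) fun S => (div_le_iff₀' hγ0).2 (hA S)
  let failWeight : Set (Fin m → P) := {q | ¬IsAccurateWeight e P A σ E (empiricalWeight P A σ q)}
  let failResidual : (Fin k → Θ) → Set (Fin m → P) := fun a => {q | e * cost P (rep a)
    < |∑ p ∈ P, (empiricalWeight P A σ q p - 1) * residual e (range (rep a)) (A (σ p)) p|}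
  have hweight := sampleProbability_not_isAccurateWeight_le (σ := σ) (m := m) hP hcA he he1 hθ
  have hresidual := productProb_iUnion_le_card_mul (E := failResidual) hμ fun a =>
    sampleProbability_residual_tail_le hP hγ he he1 hA hσ hcA (rep a)
  rw [Fintype.card_fun, Fintype.card_fin, Nat.cast_pow] at hresidual
  have hgood : (failWeight ∪ ⋃ a, failResidual a)ᶜ ⊆ {q | IsCoreset k (192 * γ * e) P
      (fun i => (q i : X)) (fun i => sampleWeight P A σ m (q i))} := by
    intro q hq
    simp only [mem_compl_iff, mem_union, mem_iUnion, not_or, not_exists] at hq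
    obtain ⟨hqWeight, hqResidual⟩ := hq
    exact isCoreset_iff_abs_sum_empiricalWeight_le.2 fun S =>
      hθ.abs_sum_sub_one_mul_pointCost_le hγ hA hσ he he1 (not_not.1 hqWeight)
        (fun l => (congrFun (hrep S).1 l).symm) (hrep S).2 (not_lt.1 (hqResidual _))
  have hfail := one_sub_productProb_le hμ (sum_samplingProb hP) hgood
  have hunion := productProb_union_le hμ failWeight (⋃ a, failResidual a)
  rw [sampleProbability_eq_productProb] at *
  linarith

theorem one_sub_le_sampleProbability_of_cost_eq_zero (hP : P.Nonempty) (hγ : 1 ≤ γ) (he : 0 ≤ e)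
    (he1 : e ≤ 1) (hA : IsApproxSolution γ P A) (hσ : IsNearestAssignment P A σ)
    (hcA : cost P A = 0) (hε : 4 * γ * e ≤ ε) :
    1 - k * (2 * Real.exp (-(m * (e ^ 2 / (16 * k)))))
      ≤ sampleProbability P A σ m {q | IsCoreset k ε P (fun i => (q i : X))
          (fun i => sampleWeight P A σ m (q i))} := by
  have hμ : ∀ p : P, 0 ≤ samplingProb P A σ p := fun p => (samplingProb_pos p.2).le
  let failCluster : Fin k → Set (Fin m → P) := fun j => {q | e * (cluster P σ j).card
    < |∑ p ∈ cluster P σ j, (empiricalWeight P A σ q p - 1)|}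
  have hcluster := productProb_iUnion_le_card_mul (E := failCluster) hμ fun j =>
    sampleProbability_cluster_card_tail_le hP he he1 j
  rw [Fintype.card_fin] at hcluster
  have hcenter : ∀ p ∈ P, p = A (σ p) := fun p hp => by
    have hzero := (Finset.sum_eq_zero_iff_of_nonneg fun p _ => pointCost_nonneg A p).1 hcA p hp
    rwa [← hσ.dist_sq_eq hp, sq_eq_zero_iff, dist_eq_zero] at hzero
  have hgood : (⋃ j, failCluster j)ᶜ ⊆ {q | IsCoreset k ε P
      (fun i => (q i : X)) (fun i => sampleWeight P A σ m (q i))} := by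
    intro q hq
    simp only [mem_compl_iff, mem_iUnion, not_exists] at hq
    refine isCoreset_iff_abs_sum_empiricalWeight_le.2 fun S => ?_
    calc |∑ p ∈ P, (empiricalWeight P A σ q p - 1) * pointCost S p|
        = |∑ p ∈ P, (empiricalWeight P A σ q p - 1) * infDist (A (σ p)) (range S) ^ 2| := by
          congr 1
          exact Finset.sum_congr rfl fun p hp => by rw [pointCost_eq_infDist_sq, ← hcenter p hp]
      _ ≤ e * (4 * γ * cost P S) :=
          abs_sum_mul_infDist_center_sq_le hγ hA hσ he (fun j => not_lt.1 (hq j)) S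
      _ = 4 * γ * e * cost P S := by ring
      _ ≤ ε * cost P S := mul_le_mul_of_nonneg_right hε (cost_nonneg P S)
  have hfail := one_sub_productProb_le hμ (sum_samplingProb hP) hgood
  rw [sampleProbability_eq_productProb]
  linarith

theorem union_bound_le {M : ℕ} (hγ : 1 ≤ γ) (hk : k ≠ 0) (hkM : k + 1 ≤ M)
    (hM : M * Real.exp (-(m * (e ^ 2 / (544 * γ ^ 2 * k)))) ≤ 1) :
    (k + 1 + M) * (2 * Real.exp (-(m * (e ^ 2 / (16 * k)))))
        + (M : ℝ) ^ k * (2 * Real.exp (-(m * (e ^ 2 / (544 * γ ^ 2)))))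
      ≤ 6 * (M * Real.exp (-(m * (e ^ 2 / (544 * γ ^ 2 * k))))) := by
  set u := M * Real.exp (-(m * (e ^ 2 / (544 * γ ^ 2 * k)))) with hu
  have hcast : (k : ℝ) + 1 ≤ M := by exact_mod_cast hkM
  have hγ2 : 1 ≤ γ ^ 2 := one_le_pow₀ hγ
  have hexp : Real.exp (-(m * (e ^ 2 / (16 * k))))
      ≤ Real.exp (-(m * (e ^ 2 / (544 * γ ^ 2 * k)))) := by
    refine Real.exp_le_exp.2 (neg_le_neg (mul_le_mul_of_nonneg_left ?_ m.cast_nonneg))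
    gcongr
    linarith
  have hpow : (M : ℝ) ^ k * Real.exp (-(m * (e ^ 2 / (544 * γ ^ 2)))) = u ^ k := by
    rw [hu, mul_pow, ← Real.exp_nat_mul]
    congr 2
    field_simp
  have hweight : (k + 1 + M) * Real.exp (-(m * (e ^ 2 / (16 * k)))) ≤ 2 * u :=
    calc (k + 1 + M) * Real.exp (-(m * (e ^ 2 / (16 * k))))
        ≤ (M + M) * Real.exp (-(m * (e ^ 2 / (544 * γ ^ 2 * k)))) := by gcongr
      _ = 2 * u := by ring
  have hresidual : u ^ k ≤ u := pow_le_of_le_one (by positivity) hM hk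
  linarith

theorem one_sub_le_sampleProbability_isCoreset [NeZero k] (hX : BallsCovered X D)
    (hP : P.Nonempty) (hγ : 1 ≤ γ) (he : 0 < e) (he1 : e ≤ 1) (hA : IsApproxSolution γ P A)
    (hσ : IsNearestAssignment P A σ) (hN : k / e ^ 2 ≤ N) (hn : 6 / e ^ 3 ≤ 2 ^ n) :
    1 - 6 * ((k * ((N + 1) * 2 ^ (D * n)) : ℕ) * Real.exp (-(m * (e ^ 2 / (544 * γ ^ 2 * k)))))
      ≤ sampleProbability P A σ m {q | IsCoreset k (192 * γ * e) P (fun i => (q i : X))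
          (fun i => sampleWeight P A σ m (q i))} := by
  have hμ : ∀ p : P, 0 ≤ samplingProb P A σ p := fun p => (samplingProb_pos p.2).le
  have hk : (0 : ℝ) < k := Nat.cast_pos.2 (NeZero.pos k)
  have hN0 : (0 : ℝ) < N := (by positivity : 0 < k / e ^ 2).trans_le hN
  have hkM : k + 1 ≤ k * ((N + 1) * 2 ^ (D * n)) :=
    calc k + 1 ≤ k * ((1 + 1) * 1) := by linarith [NeZero.one_le (n := k)]
      _ ≤ k * ((N + 1) * 2 ^ (D * n)) := by
        gcongr
        · exact Nat.cast_pos.1 hN0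
        · exact Nat.one_le_two_pow
  set M := k * ((N + 1) * 2 ^ (D * n)) with hM
  rcases le_total 1 (M * Real.exp (-(m * (e ^ 2 / (544 * γ ^ 2 * k))))) with hlarge | hsmall
  · exact (by linarith : 1 - 6 * (M * Real.exp (-(m * (e ^ 2 / (544 * γ ^ 2 * k))))) ≤ 0).trans
      (productProb_nonneg hμ _)
  have hbound := union_bound_le hγ (NeZero.ne k) hkM hsmall
  rcases (cost_nonneg P A).eq_or_lt with hcA | hcA
  · have hzero := one_sub_le_sampleProbability_of_cost_eq_zero (ε := 192 * γ * e) (m := m) hP hγ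
      he.le he1 hA hσ hcA.symm (by gcongr; norm_num)
    have hrest : 0 ≤ (1 + M) * (2 * Real.exp (-(m * (e ^ 2 / (16 * k)))))
        + (M : ℝ) ^ k * (2 * Real.exp (-(m * (e ^ 2 / (544 * γ ^ 2))))) := by positivity
    linarith
  · obtain ⟨θ, E, hθ⟩ := hX.exists_isCenterClassification P A he (Nat.cast_pos.1 hN0) hn
    have hlevel : cost P A / N ≤ e ^ 2 / k * cost P A := by
      rw [div_le_iff₀ hN0, mul_right_comm]
      refine le_mul_of_one_le_left hcA.le ?_
      rw [div_le_iff₀ (by positivity)] at hN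
      rwa [div_mul_eq_mul_div, one_le_div hk, mul_comm]
    have hpos := one_sub_le_sampleProbability_of_isCenterClassification (m := m) hP hγ he he1 hA hσ
      hcA { hθ with cost_le := fun a => (hθ.cost_le a).trans hlevel }
    rw [show Fintype.card (Fin k × Fin (N + 1) × Fin (2 ^ (D * n))) = M by simp [hM]] at hpos
    linarith

theorem mul_ceil_add_one_mul_two_pow_le (hk : 1 ≤ k) (he : 0 < e) (he1 : e ≤ 1)
    (hn : (2 : ℝ) ^ n ≤ 12 / e ^ 3) :
    ((k * ((⌈k / e ^ 2⌉₊ + 1) * 2 ^ (D * n)) : ℕ) : ℝ) ≤ (2 * k / e) ^ (4 * D + 2) := by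
  have hk' : (1 : ℝ) ≤ k := Nat.one_le_cast.2 hk
  have hlevels : (k : ℝ) * (⌈k / e ^ 2⌉₊ + 1) ≤ (2 * k / e) ^ 2 := by
    have hceil := Nat.ceil_lt_add_one (by positivity : 0 ≤ (k : ℝ) / e ^ 2)
    have hone : 1 ≤ (k : ℝ) / e ^ 2 :=
      (one_le_div (by positivity)).2 ((pow_le_one₀ he.le he1).trans hk')
    calc (k : ℝ) * (⌈k / e ^ 2⌉₊ + 1) ≤ k * (4 * (k / e ^ 2)) := by gcongr; linarith
      _ = (2 * k / e) ^ 2 := by ring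
  have hcells : (2 : ℝ) ^ n ≤ (2 * k / e) ^ 4 :=
    calc (2 : ℝ) ^ n ≤ 12 / e ^ 3 := hn
      _ ≤ 16 * 1 ^ 4 / (e ^ 3 * 1) := by gcongr <;> norm_num
      _ ≤ 16 * k ^ 4 / (e ^ 3 * e) := by gcongr
      _ = (2 * k / e) ^ 4 := by ring
  push_cast
  calc (k : ℝ) * ((⌈k / e ^ 2⌉₊ + 1) * 2 ^ (D * n))
      = k * (⌈k / e ^ 2⌉₊ + 1) * (2 ^ n) ^ D := by rw [mul_comm D n, pow_mul]; ring
    _ ≤ (2 * k / e) ^ 2 * ((2 * k / e) ^ 4) ^ D := by gcongr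
    _ = (2 * k / e) ^ (4 * D + 2) := by rw [← pow_mul, ← pow_add, add_comm]

theorem one_sub_le_sampleProbability_of_le_mul_sq {δ : ℝ} [NeZero k] (hX : BallsCovered X D)
    (hP : P.Nonempty) (hγ : 1 ≤ γ) (hδ : 0 < δ) (he : 0 < e) (he1 : e ≤ 1)
    (hA : IsApproxSolution γ P A) (hσ : IsNearestAssignment P A σ)
    (hm : 544 * γ ^ 2 * k * ((4 * D + 2) * Real.log (2 * k / e) + Real.log (6 / δ)) ≤ m * e ^ 2) :
    1 - δ ≤ sampleProbability P A σ m {q | IsCoreset k (192 * γ * e) P (fun i => (q i : X))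
      (fun i => sampleWeight P A σ m (q i))} := by
  have hk : (0 : ℝ) < k := Nat.cast_pos.2 (NeZero.pos k)
  obtain ⟨n, hn, hn'⟩ := exists_nat_pow_near (x := 6 / e ^ 3) (y := 2)
    ((one_le_div (by positivity)).2 ((pow_le_one₀ he.le he1).trans (by norm_num))) one_lt_two
  have hn'' : (2 : ℝ) ^ (n + 1) ≤ 12 / e ^ 3 := by
    rw [pow_succ, show 12 / e ^ 3 = 6 / e ^ 3 * 2 by ring]
    gcongr
  have hcoreset := one_sub_le_sampleProbability_isCoreset (m := m) hX hP hγ he he1 hA hσ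
    (Nat.le_ceil _) hn'.le
  have hcard := mul_ceil_add_one_mul_two_pow_le (D := D) (NeZero.one_le (n := k)) he he1 hn''
  set x : ℝ := 2 * k / e
  have hx : 0 < x := by positivity
  have hexp : Real.exp (-(m * (e ^ 2 / (544 * γ ^ 2 * k)))) ≤ (x ^ (4 * D + 2))⁻¹ * (δ / 6) :=
    calc Real.exp (-(m * (e ^ 2 / (544 * γ ^ 2 * k))))
        ≤ Real.exp (-((4 * D + 2) * Real.log x + Real.log (6 / δ))) := by
          refine Real.exp_le_exp.2 (neg_le_neg ?_)
          rwa [← mul_div_assoc, le_div_iff₀' (by positivity)]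
      _ = (x ^ (4 * D + 2))⁻¹ * (δ / 6) := by
          rw [neg_add, Real.exp_add, Real.exp_neg, Real.exp_neg, Real.exp_log (by positivity),
            inv_div, ← Real.exp_log (pow_pos hx (4 * D + 2)), Real.log_pow]
          push_cast
          rfl
  have hfail := mul_le_mul hcard hexp (Real.exp_nonneg _) (by positivity)
  rw [mul_inv_cancel_left₀ (by positivity)] at hfail
  linarith

theorem sampleProbability_isCoreset_eq_one [Subsingleton X] [NeZero k] (hP : P.Nonempty) :
    sampleProbability P A σ m {q | IsCoreset k ε P (fun i => (q i : X))
      (fun i => sampleWeight P A σ m (q i))} = 1 := by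
  have hzero : ∀ (S : Fin k → X) (p : X), pointCost S p = 0 := fun S p => by
    simp [pointCost, fun j => dist_eq_zero.2 (Subsingleton.elim p (S j))]
  have huniv : {q : Fin m → P | IsCoreset k ε P (fun i => (q i : X))
      (fun i => sampleWeight P A σ m (q i))} = univ :=
    eq_univ_of_forall fun q S => by simp [cost, hzero]
  rw [huniv]
  exact productProb_univ (sum_samplingProb hP)

end Failure

section SampleSize
variable {k D m : ℕ} {γ δ ε : ℝ}

/-- The constant `C(γ, δ)` in the lower bound for the number of samples. The factor `(192 * γ) ^ 2`
accounts for running the argument with precision `ε / (192 * γ)`. -/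
def sampleConstant (γ δ : ℝ) : ℝ :=
  544 * γ ^ 2 * (192 * γ) ^ 2 * (6 * (1 + Real.logb 2 (192 * γ)) + Real.logb 2 (6 / δ))

theorem sampleConstant_pos (hγ : 1 ≤ γ) (hδ : 0 < δ) (hδ1 : δ ≤ 1) : 0 < sampleConstant γ δ := by
  have hlogγ : 0 < Real.logb 2 (192 * γ) := Real.logb_pos one_lt_two (by linarith)
  have hlogδ : 0 < Real.logb 2 (6 / δ) :=
    Real.logb_pos one_lt_two ((one_lt_div hδ).2 (by linarith))
  unfold sampleConstant
  positivity

theorem le_mul_sq_of_sampleConstant_le (hγ : 1 ≤ γ) (hδ : 0 < δ) (hδ1 : δ ≤ 1) (hk : 1 ≤ k)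
    (hD : 1 ≤ D) (hε : 0 < ε) (hε1 : ε ≤ 1)
    (hm : sampleConstant γ δ * k * D * Real.log (2 * k / ε) / ε ^ 2 ≤ m) :
    544 * γ ^ 2 * k * ((4 * D + 2) * Real.log (2 * k / (ε / (192 * γ))) + Real.log (6 / δ))
      ≤ m * (ε / (192 * γ)) ^ 2 := by
  have hk' : (1 : ℝ) ≤ k := Nat.one_le_cast.2 hk
  have hD' : (1 : ℝ) ≤ D := Nat.one_le_cast.2 hD
  have hlog2 : 0 < Real.log 2 := Real.log_pos one_lt_two
  set L := Real.log (2 * k / ε)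
  have hL : Real.log 2 ≤ L := Real.log_le_log two_pos ((le_div_iff₀ hε).2 (by nlinarith))
  have hlog : ∀ x : ℝ, 1 ≤ x → Real.log x ≤ Real.logb 2 x * L := fun x hx =>
    calc Real.log x = Real.logb 2 x * Real.log 2 := (div_mul_cancel₀ _ hlog2.ne').symm
      _ ≤ Real.logb 2 x * L := mul_le_mul_of_nonneg_left hL (Real.logb_nonneg one_lt_two hx)
  have hlogk : Real.log (2 * k / (ε / (192 * γ))) ≤ (1 + Real.logb 2 (192 * γ)) * L := by
    rw [div_div_eq_mul_div, mul_div_right_comm, Real.log_mul (by positivity) (by positivity)]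
    linarith [hlog (192 * γ) (by linarith)]
  have hlogδ : Real.log (6 / δ) ≤ Real.logb 2 (6 / δ) * (D * L) := by
    have hδ6 : 1 ≤ 6 / δ := (one_le_div hδ).2 (by linarith)
    calc Real.log (6 / δ) ≤ Real.logb 2 (6 / δ) * L := hlog _ hδ6
      _ ≤ Real.logb 2 (6 / δ) * (D * L) := by
        gcongr
        · exact Real.logb_nonneg one_lt_two hδ6
        · exact le_mul_of_one_le_left (hlog2.le.trans hL) hD'
  rw [div_pow, ← mul_div_assoc, le_div_iff₀ (by positivity)]
  rw [div_le_iff₀ (by positivity)] at hm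
  calc 544 * γ ^ 2 * k * ((4 * D + 2) * Real.log (2 * k / (ε / (192 * γ))) + Real.log (6 / δ))
        * (192 * γ) ^ 2
      ≤ 544 * γ ^ 2 * k * (6 * D * ((1 + Real.logb 2 (192 * γ)) * L)
        + Real.logb 2 (6 / δ) * (D * L)) * (192 * γ) ^ 2 := by
        gcongr
        · exact Real.log_nonneg ((one_le_div (by positivity)).2
            ((div_le_self hε.le (by linarith)).trans (by linarith)))
        · linarith
    _ = sampleConstant γ δ * k * D * L := by unfold sampleConstant; ring
    _ ≤ m * ε ^ 2 := hm

end SampleSize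

end KMeans

end

theorem theorem4 :
    ∃ c : ℕ, ∀ γ δ : ℝ, 1 ≤ γ → 0 < δ → δ < 1 → ∃ C : ℝ, 0 < C ∧
      ∀ (X : Type*) [MetricSpace X] (D k : ℕ) (ε : ℝ) (P : Finset X) (A : Fin k → X)
        (σ : X → Fin k) (m : ℕ),
        doublingDim X ≤ D → 1 ≤ k → 0 < ε → ε < 1 → P.Nonempty →
        IsApproxSolution γ P A → IsNearestAssignment P A σ →
        C * k * D * Real.log (2 * k / ε) ^ c / ε ^ 2 ≤ m →
        1 - δ ≤ sampleProbability P A σ m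
          {q | IsCoreset k ε P (fun i => (q i : X)) (fun i => sampleWeight P A σ m (q i))} := by
  refine ⟨1, fun γ δ hγ hδ hδ1 => ⟨sampleConstant γ δ, sampleConstant_pos hγ hδ hδ1.le, ?_⟩⟩
  intro X _ D k ε P A σ m hdim hk hε hε1 hP hA hσ hm
  have : NeZero k := ⟨Nat.one_le_iff_ne_zero.1 hk⟩
  have hX : BallsCovered X D := ballsCovered_of_doublingDim_le hdim
  rcases D.eq_zero_or_pos with rfl | hD
  · have := hX.subsingleton
    rw [sampleProbability_isCoreset_eq_one hP]
    exact sub_le_self 1 hδ.le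
  · rw [pow_one] at hm
    have hγ' : 1 ≤ 192 * γ := by linarith
    have hγ0 : 0 < 192 * γ := by linarith
    have hcoreset := one_sub_le_sampleProbability_of_le_mul_sq hX hP hγ hδ (div_pos hε hγ0)
      ((div_le_self hε.le hγ').trans hε1.le) hA hσ
      (le_mul_sq_of_sampleConstant_le hγ hδ hδ1.le hk hD hε hε1.le hm)
    rwa [mul_div_cancel₀ ε hγ0.ne'] at hcoreset
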